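/- **Setting.** Let $d\ge 1$ be an integer, $\eta>0$ a real constant and $\ell\ge 0$ a fixed number of iterations. For a positive integer $k$ and positive integers $f_0,\dots,f_{d-1}$ with $f_i=\eta k+O(1)$, let $\mathcal C_1^k$ be the ensemble of bipartite graphs with $k$ variable nodes and $n_b=\sum_i f_i$ check nodes, the check nodes being partitioned into $d$ subsets of sizes $f_0,\dots,f_{d-1}$, in which every variable node is joined to exactly one check node of each of the $d$ subsets. A random graph of the ensemble is obtained by choosing all these neighbours independently and uniformly at random. One iteration of the peeling decoder selects all edges whose check node currently has degree $1$, and removes from the graph all edges at the variable nodes of the selected edges. Let $Z$ be the number of edges that are not decoded, i.e. that still are in the graph, after $\ell$ iterations of the peeling decoder on a random graph of the ensemble. Let $p_0=1$ and $p_{j+1}=\bigl(1-e^{-p_j/\eta}\bigr)^{d-1}$ for $j\ge 0$. **Lemma (Convergence to cycle-free case).** There is a constant $\beta>0$, depending only on $d$, $\eta$ and $\ell$, such that for every $\epsilon_1>0$ and every $C$ there is a $K$ such that for all $k\ge K$ and all $f_0,\dots,f_{d-1}$ with $|f_i-\eta k|\le C$ for all $i$: (a) $\mathbb E[Z]<2kd\,p_\ell$;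 (b) $\Pr\bigl(|Z-\mathbb E[Z]|>kd\,\epsilon_1\bigr)<e^{-\beta\,\epsilon_1^2\,k^{1/(4\ell+1)}}$. -/

import Mathlib

open MeasureTheory ProbabilityTheory

/-- The check nodes: they are partitioned into `d` subsets, the `i`-th having `f i` nodes. -/
abbrev CheckNode {d : ℕ} (f : Fin d → ℕ) : Type := (i : Fin d) × Fin (f i)

/-- The balls-and-bins ensemble with `k` variable nodes: for every variable node and every one of
the `d` subsets of check nodes, one neighbouring check node in that subset. -/
abbrev BinsGraph (k : ℕ) {d : ℕ} (f : Fin d → ℕ) : Type := Fin k → (i : Fin d) → Fin (f i)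

/-- The uniform distribution on the ensemble, i.e. all the neighbours are chosen
independently and uniformly at random. -/
noncomputable def ensembleLaw (k : ℕ) {d : ℕ} (f : Fin d → ℕ) : Measure (BinsGraph k f) :=
  uniformOn Set.univ

/-- The set of edges (pairs of a variable node and a check node) of a graph of the ensemble. -/
def edges {k d : ℕ} {f : Fin d → ℕ} (G : BinsGraph k f) : Finset (Fin k × CheckNode f) :=
  Finset.univ.filter fun e => G e.1 e.2.1 = e.2.2

/-- The degree of the check node `c` in the bipartite graph with edge set `E`. -/
def checkDegree {V C : Type} [DecidableEq C] (E : Finset (V × C)) (c : C) : ℕ :=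
  (E.filter fun e => e.2 = c).card

/-- One iteration of the peeling decoder: select all edges `e'` whose check node has degree one,
and remove all edges at the variable nodes of the selected edges. -/
def peelStep {V C : Type} [DecidableEq V] [DecidableEq C] (E : Finset (V × C)) :
    Finset (V × C) :=
  E.filter fun e => ¬ ∃ e' ∈ E, checkDegree E e'.2 = 1 ∧ e'.1 = e.1

/-- The number `Z` of edges that are still present after `ℓ` iterations of the peeling decoder. -/
def undecodedEdges (ℓ : ℕ) {k d : ℕ} {f : Fin d → ℕ} (G : BinsGraph k f) : ℕ :=
  (peelStep^[ℓ] (edges G)).card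

/-- The density evolution `p₀ = 1`, `p_{j+1} = (1 - exp (-p_j / η)) ^ (d - 1)` (for `d ≥ 1`). -/
noncomputable def densityEvolution (d : ℕ) (η : ℝ) : ℕ → ℝ
  | 0 => 1
  | j + 1 => (1 - Real.exp (-(densityEvolution d η j / η))) ^ (d - 1)

/-! A variable node is removed by peeling exactly when one of its check nodes has no other remaining
neighbour. Since all its edges go at once, `Z` is `d` times the number of nodes that survive in the
sense of the recursion `survives` with `nxt = fun _ => none` (`undecodedEdges_eq`).

Concentration: if all check degrees are at most `y`, changing the choices of one variable node
alters the status of at most `(4dy)^ℓ` nodes (`card_survivors_sub_le`). With `y = k^(1/(4ℓ+1))`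
large degrees are exponentially rare. The survivor count, restricted to good graphs, is extended to
a Lipschitz function of independent choices, for which the exponential moment method applies
(`prob_not_lt_deviation_le`).

Mean: the non-backtracking variant `nxt = some` has at least as many survivors, and its survivor
proportion tends to `p_ℓ > 0`, which leaves room below `2 p_ℓ`. To see this, let `N` be the number
of surviving rivals of a node at its check nodes with class in a set `A`. In `E[N θ^(N-1)]` each
rival is a planted edge. Unless there is a short cycle, which has vanishing probability, planting
raises `N` by exactly one, so this expectation is the mean of `θ^N` times a normalised survivor
count. By concentration that count is nearly a constant `b`. Hence the generating function of `N`
nearly solves `g' = |A| b g`, so `P(N = 0)` is near `exp(-|A| b)`. Inclusion–exclusion over `A`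
yields one step of density evolution. -/

namespace PeelingDecoder
open Finset Filter Topology
open scoped BigOperators Classical
variable {k d : ℕ} {f : Fin d → ℕ}

/-! ### The survival recursion and planted edges -/

/-- `survives nxt G j o v`: variable node `v` survives `j` rounds of peeling when its check node of
class `o` (if any) is ignored; its competitors at its check node of class `i` are examined with
ignored class `nxt i`. For `nxt = fun _ => none` this is the peeling decoder, for `nxt = some` its
non-backtracking variant. -/
def survives (nxt : Fin d → Option (Fin d)) (G : BinsGraph k f) :
    ℕ → Option (Fin d) → Fin k → Prop
  | 0, _, _ => True
  | j + 1, o, v => ∀ i, some i ≠ o → ∃ u, u ≠ v ∧ G u i = G v i ∧ survives nxt G j (nxt i) u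

/-- The number of variable nodes that survive `j` rounds. -/
noncomputable def survivors (nxt : Fin d → Option (Fin d)) (j : ℕ) (o : Option (Fin d))
    (G : BinsGraph k f) : ℕ :=
  #{v | survives nxt G j o v}

/-- Redirect the edge of class `i` at the variable node `u` to the check node `x`. -/
def setEdge (G : BinsGraph k f) (u : Fin k) (i : Fin d) (x : Fin (f i)) : BinsGraph k f :=
  Function.update G u (Function.update (G u) i x)

@[simp] lemma setEdge_self (G : BinsGraph k f) (u : Fin k) (i : Fin d) (x : Fin (f i)) :
    setEdge G u i x u i = x := by simp [setEdge]

lemma setEdge_of_ne (G : BinsGraph k f) {u v : Fin k} {i i' : Fin d} (x : Fin (f i))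
    (h : v ≠ u ∨ i' ≠ i) : setEdge G u i x v i' = G v i' := by
  unfold setEdge
  by_cases hv : v = u
  · subst hv
    simp [Function.update_of_ne (h.resolve_left (not_not_intro rfl))]
  · simp [Function.update_of_ne hv]

lemma setEdge_setEdge (G : BinsGraph k f) (u : Fin k) (i : Fin d) (x : Fin (f i)) :
    setEdge (setEdge G u i x) u i (G u i) = G := by simp [setEdge]

/-- Redirecting an edge to a uniformly random check node preserves the uniform distribution. -/
lemma expect_setEdge (u : Fin k) {i : Fin d} (hi : f i ≠ 0) (F : BinsGraph k f → ℝ) :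
    𝔼 G, F G = 𝔼 G, 𝔼 x, F (setEdge G u i x) := by
  have : Nonempty (Fin (f i)) := ⟨⟨0, Nat.pos_of_ne_zero hi⟩⟩
  let e : BinsGraph k f × Fin (f i) → BinsGraph k f × Fin (f i) :=
    fun p => (setEdge p.1 u i p.2, p.1 u i)
  have he : Function.Involutive e := fun p => by simp [e, setEdge_setEdge]
  calc 𝔼 G, F G = 𝔼 G : BinsGraph k f, 𝔼 _x : Fin (f i), F G := by
        simp
    _ = 𝔼 p : BinsGraph k f × Fin (f i), F p.1 :=
        (expect_product' univ univ fun G (_ : Fin (f i)) => F G).symm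
    _ = 𝔼 p : BinsGraph k f × Fin (f i), F (setEdge p.1 u i p.2) :=
        (Fintype.expect_equiv he.toPerm _ _ fun p => rfl).symm
    _ = _ := expect_product' univ univ fun G (x : Fin (f i)) => F (setEdge G u i x)

/-- Planting an edge: the event that the edge of class `i` at `u` goes to a check node chosen
independently of it. -/
lemma expect_edge_eq (u : Fin k) {i : Fin d} (hi : f i ≠ 0) (h : BinsGraph k f → Fin (f i))
    (hh : ∀ G x, h (setEdge G u i x) = h G) (F : BinsGraph k f → ℝ) :
    𝔼 G, (if G u i = h G then F G else 0) = (1 / (f i : ℝ)) * 𝔼 G, F (setEdge G u i (h G)) := by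
  have : Nonempty (Fin (f i)) := ⟨⟨0, Nat.pos_of_ne_zero hi⟩⟩
  rw [expect_setEdge u hi, mul_expect]
  refine expect_congr rfl fun G _ => ?_
  simp only [setEdge_self, hh]
  rw [Fintype.expect_eq_sum_div_card]
  simp [Finset.sum_ite_eq', div_eq_inv_mul]

/-! ### Probabilities as averages -/

/-- The probability of an event. -/
noncomputable def prob {α : Type*} [Fintype α] (P : α → Prop) : ℝ := 𝔼 a, if P a then 1 else 0

lemma prob_nonneg {α : Type*} [Fintype α] (P : α → Prop) : 0 ≤ prob P :=
  expect_nonneg fun a _ => by split_ifs <;> simp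

lemma prob_mono {α : Type*} [Fintype α] {P Q : α → Prop} (h : ∀ a, P a → Q a) :
    prob P ≤ prob Q :=
  expect_le_expect fun a _ => by
    by_cases hP : P a
    · simp [hP, h a hP]
    · simp only [hP, if_false]; split_ifs <;> simp

lemma prob_le_one {α : Type*} [Fintype α] (P : α → Prop) : prob P ≤ 1 := by
  cases isEmpty_or_nonempty α
  · simp [prob]
  · exact expect_le univ_nonempty fun a _ => by split_ifs <;> simp

lemma prob_exists_le {α ι : Type*} [Fintype α] (s : Finset ι) (P : ι → α → Prop) :
    prob (fun a => ∃ i ∈ s, P i a) ≤ ∑ i ∈ s, prob (P i) := by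
  unfold prob
  rw [← expect_sum_comm]
  refine expect_le_expect fun a _ => ?_
  split_ifs with h
  · obtain ⟨i, hi, h⟩ := h
    calc (1 : ℝ) = if P i a then 1 else 0 := by simp [h]
      _ ≤ _ := single_le_sum (f := fun i => if P i a then (1 : ℝ) else 0)
        (fun j _ => by split_ifs <;> simp) hi
  · exact sum_nonneg fun j _ => by split_ifs <;> simp

lemma prob_or_le {α : Type*} [Fintype α] (P Q : α → Prop) :
    prob (fun a => P a ∨ Q a) ≤ prob P + prob Q := by
  unfold prob
  rw [← expect_add_distrib]
  refine expect_le_expect fun a _ => ?_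
  by_cases hP : P a <;> by_cases hQ : Q a <;> simp [hP, hQ]

lemma prob_and_edge_eq (u : Fin k) {i : Fin d} (hi : f i ≠ 0) (h : BinsGraph k f → Fin (f i))
    (hh : ∀ G x, h (setEdge G u i x) = h G) (P : BinsGraph k f → Prop)
    (hP : ∀ G x, P (setEdge G u i x) ↔ P G) :
    prob (fun G : BinsGraph k f => P G ∧ G u i = h G) = (1 / (f i : ℝ)) * prob P := by
  unfold prob
  have := expect_edge_eq u hi h hh fun G => if P G then 1 else 0
  simp only [hP] at this
  rw [← this]
  refine expect_congr rfl fun G _ => ?_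
  by_cases h1 : P G <;> by_cases h2 : G u i = h G <;> simp [h1, h2]

/-! ### Short cycles are rare -/

/-- A non-backtracking walk of at most `r` steps from `v`, whose first step does not use class `o`,
and which visits new nodes until it comes back to the set `V` of nodes visited before. -/
def revisits (G : BinsGraph k f) : ℕ → Finset (Fin k) → Fin k → Option (Fin d) → Prop
  | 0, _, _, _ => False
  | r + 1, V, v, o => ∃ i, some i ≠ o ∧ ∃ x, x ≠ v ∧ G x i = G v i ∧
      (x ∈ V ∨ revisits G r (insert x V) x (some i))

/-- Bound for the probability of `revisits`, for `n` visited nodes and classes of at least `m`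
check nodes. -/
noncomputable def revisitBound (d : ℕ) (k m : ℝ) : ℕ → ℕ → ℝ
  | 0, _ => 0
  | r + 1, n => d * (n * (1 / m) + k * (1 / m * revisitBound d k m r (n + 1)))

lemma revisitBound_nonneg {m x : ℝ} (hm : 0 < m) (hx : 0 ≤ x) (d r n : ℕ) :
    0 ≤ revisitBound d x m r n := by
  induction r generalizing n with
  | zero => simp [revisitBound]
  | succ r ih =>
    have := ih (n + 1)
    unfold revisitBound
    positivity

/-- The walk is exposed edge by edge. The event `P` records what is already exposed: it ignores all
edges at nodes outside `V` and the edges at `v` of classes other than `o`. So an old node `x ∈ V` is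
met through the fresh edge at `v`, and a new node `x` through its own fresh edge of class `i`, each
with probability `1 / f i`. In the second case the event that `P` holds and `x` is met is again of
the required kind for `insert x V`. -/
lemma prob_revisits {m : ℝ} (hm : 0 < m) (hf : ∀ i, m ≤ f i) (r : ℕ) :
    ∀ (V : Finset (Fin k)) (v : Fin k) (o : Option (Fin d)) (P : BinsGraph k f → Prop), v ∈ V →
      (∀ G u i x, (u ∉ V ∨ (u = v ∧ some i ≠ o)) → (P (setEdge G u i x) ↔ P G)) →
      prob (fun G => P G ∧ revisits G r V v o) ≤ revisitBound d k m r #V * prob P := by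
  have hf0 : ∀ i, f i ≠ 0 := fun i h => by
    have := hf i
    rw [h] at this
    simp at this
    linarith
  have hinv : ∀ i, 1 / (f i : ℝ) ≤ 1 / m := fun i => one_div_le_one_div_of_le hm (hf i)
  induction r with
  | zero => intro V v o P _ _; simp [revisits, revisitBound, prob]
  | succ r ih =>
    intro V v o P hv hP
    have hB := revisitBound_nonneg hm (Nat.cast_nonneg k) d r (#V + 1)
    have hP0 := prob_nonneg P
    have key : ∀ i : Fin d, some i ≠ o →
        prob (fun G => (∃ x ∈ V, x ≠ v ∧ P G ∧ G v i = G x i) ∨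
          (∃ x ∈ univ \ V, (P G ∧ G x i = G v i) ∧ revisits G r (insert x V) x (some i))) ≤
        #V * (1 / m) * prob P + k * (1 / m * revisitBound d k m r (#V + 1)) * prob P := by
      intro i hi
      refine (prob_or_le _ _).trans (add_le_add ?_ ?_)
      · refine (prob_exists_le _ _).trans ?_
        rw [mul_assoc, ← nsmul_eq_mul]
        refine sum_le_card_nsmul _ _ _ fun x _ => ?_
        by_cases hx : x = v
        · simp only [hx, ne_eq, not_true_eq_false, false_and]
          simp only [prob, if_false, expect_const_zero]
          positivity
        · refine (prob_mono (Q := fun G => P G ∧ G v i = G x i) fun G h => h.2).trans ?_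
          rw [prob_and_edge_eq v (hf0 i) (fun G => G x i)
            (fun G y => setEdge_of_ne _ _ (.inl hx)) P fun G y => hP G v i y (.inr ⟨rfl, hi⟩)]
          exact mul_le_mul_of_nonneg_right (hinv i) hP0
      · refine (prob_exists_le _ _).trans ?_
        have hcard : #(univ \ V) ≤ k := (card_le_univ _).trans (by simp)
        refine (sum_le_card_nsmul _ _ (1 / m * revisitBound d k m r (#V + 1) * prob P)
          fun x hx => ?_).trans ?_
        · have hx : x ∉ V := (mem_sdiff.1 hx).2
          have hxv : v ≠ x := fun h => hx (h ▸ hv)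
          refine (ih (insert x V) x (some i) _ (mem_insert_self _ _) ?_).trans ?_
          · intro G u i' y hu
            have h1 : u ∉ V := by
              rcases hu with hu | ⟨rfl, _⟩
              · exact fun h => hu (mem_insert_of_mem h)
              · exact hx
            have h2 : x ≠ u ∨ i ≠ i' := by
              rcases hu with hu | ⟨_, hu⟩
              · exact .inl fun h => hu (h ▸ mem_insert_self _ _)
              · exact .inr fun h => hu (h ▸ rfl)
            rw [hP G u i' y (.inl h1), setEdge_of_ne _ _ h2,
              setEdge_of_ne _ _ (.inl fun h : v = u => h1 (h ▸ hv))]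
          · rw [card_insert_of_notMem hx, prob_and_edge_eq x (hf0 i) (fun G => G v i)
              (fun G y => setEdge_of_ne _ _ (.inl hxv)) P fun G y => hP G x i y (.inl hx)]
            calc _ = (1 / (f i : ℝ)) * (revisitBound d k m r (#V + 1) * prob P) := by ring
              _ ≤ (1 / m) * (revisitBound d k m r (#V + 1) * prob P) :=
                mul_le_mul_of_nonneg_right (hinv i) (by positivity)
              _ = _ := by ring
        · rw [nsmul_eq_mul, mul_assoc (k : ℝ)]
          exact mul_le_mul_of_nonneg_right (by exact_mod_cast hcard) (by positivity)
    calc prob (fun G => P G ∧ revisits G (r + 1) V v o)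
        ≤ prob (fun G => ∃ i ∈ (univ.filter fun i => some i ≠ o),
          (∃ x ∈ V, x ≠ v ∧ P G ∧ G v i = G x i) ∨
          (∃ x ∈ univ \ V, (P G ∧ G x i = G v i) ∧ revisits G r (insert x V) x (some i))) := by
          refine prob_mono fun G ⟨h, i, hi, x, hx, hG, h'⟩ => ⟨i, by simpa using hi, ?_⟩
          by_cases hxV : x ∈ V
          · exact .inl ⟨x, hxV, hx, h, hG.symm⟩
          · exact .inr ⟨x, by simpa using hxV, ⟨h, hG⟩, h'.resolve_left hxV⟩
      _ ≤ _ := prob_exists_le _ _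
      _ ≤ _ := sum_le_card_nsmul _ _ _ fun i hi => key i (by simpa using hi)
      _ ≤ d * (#V * (1 / m) * prob P + k * (1 / m * revisitBound d k m r (#V + 1)) * prob P) := by
          rw [nsmul_eq_mul]
          refine mul_le_mul_of_nonneg_right ?_ (by positivity)
          exact_mod_cast (card_le_univ _).trans (by simp)
      _ = _ := by rw [revisitBound]; ring

lemma prob_revisits_le {m : ℝ} (hm : 0 < m) (hf : ∀ i, m ≤ f i) (r : ℕ) (V : Finset (Fin k))
    (v : Fin k) (o : Option (Fin d)) (hv : v ∈ V) :
    prob (fun G : BinsGraph k f => revisits G r V v o) ≤ revisitBound d k m r #V := by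
  have := prob_revisits hm hf r V v o (fun _ => True) hv fun _ _ _ _ _ => Iff.rfl
  simp only [true_and] at this
  refine this.trans (mul_le_of_le_one_right ?_ (prob_le_one _))
  exact revisitBound_nonneg hm (Nat.cast_nonneg k) d r _

/-! ### The effect of planting one edge -/

/-- The surviving competitors of `w` at its check node of class `i`. -/
noncomputable def rivals (j : ℕ) (G : BinsGraph k f) (w : Fin k) (i : Fin d) : Finset (Fin k) :=
  {u | u ≠ w ∧ G u i = G w i ∧ survives some G j (some i) u}

section Redirect

variable {G : BinsGraph k f} {u w : Fin k} {c : Fin d}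

/-- Evaluating `survives` explores non-backtracking walks. The redirected edge can be noticed only
by a walk that reaches `u`, or `w` at whose check node `u` now appears. Both lie in `V`, to which no
walk returns; a walk starting at `u` itself does not use class `c`. -/
lemma survives_setEdge (huw : u ≠ w) (j : ℕ) :
    ∀ (V : Finset (Fin k)) (v : Fin k) (o : Option (Fin d)), u ∈ V → w ∈ V → v ∈ V → v ≠ w →
      (v = u → o = some c) → ¬ revisits G j V v o →
      (survives some (setEdge G u c (G w c)) j o v ↔ survives some G j o v) := by
  induction j with
  | zero => intros; rfl
  | succ j ih =>
    intro V v o hu hw hv hvw hvu hr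
    simp only [revisits, not_exists, not_and, not_or] at hr
    refine forall_congr' fun i => imp_congr_right fun hi => exists_congr fun x =>
      and_congr_right fun hx => ?_
    have hvi : setEdge G u c (G w c) v i = G v i := setEdge_of_ne _ _ <| by
      by_contra! h
      exact hi (by rw [hvu h.1, h.2])
    rw [hvi]
    have hxu : x = u → (setEdge G u c (G w c) x i = G v i ↔ G x i = G v i) := by
      rintro rfl
      by_cases hic : i = c
      · subst hic
        rw [setEdge_self]
        exact ⟨fun h => absurd hw (hr i hi w hvw.symm h).1, fun h => absurd hu (hr i hi x hx h).1⟩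
      · rw [setEdge_of_ne _ _ (.inr hic)]
    have hx' : setEdge G u c (G w c) x i = G v i ↔ G x i = G v i := by
      by_cases h : x = u
      · exact hxu h
      · rw [setEdge_of_ne _ _ (.inl h)]
    rw [hx']
    refine and_congr_right fun hG => ?_
    obtain ⟨h1, h2⟩ := hr i hi x hx hG
    refine ih (insert x V) x (some i) (mem_insert_of_mem hu) (mem_insert_of_mem hw)
      (mem_insert_self _ _) (fun h => h1 (h ▸ hw)) (fun h => absurd hu (h ▸ h1)) h2

/-- Unless there is a short cycle, redirecting the edge of class `c` at `u` to the check node of `w`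
makes `u` a new competitor of `w` and affects no other competitor. -/
lemma rivals_setEdge (huw : u ≠ w) (j : ℕ) (h₁ : ¬ revisits G (j + 1) {u, w} w none)
    (h₂ : ¬ revisits G j {u, w} u (some c)) (i : Fin d) :
    u ∉ rivals j G w i ∧ rivals j (setEdge G u c (G w c)) w i =
      if i = c ∧ survives some G j (some c) u then insert u (rivals j G w i)
      else rivals j G w i := by
  simp only [revisits, not_exists, not_and, not_or] at h₁
  have hu := survives_setEdge huw j {u, w} u (some c) (by simp) (by simp) (by simp) huw
    (fun _ => rfl) h₂
  have hni : G u i ≠ G w i := fun h => (h₁ i (by simp) u huw h).1 (by simp)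
  refine ⟨by simp [rivals, hni], ?_⟩
  have hw : setEdge G u c (G w c) w i = G w i := setEdge_of_ne _ _ (.inl huw.symm)
  ext x
  by_cases hxu : x = u
  · subst hxu
    by_cases hic : i = c
    · subst hic
      by_cases hs : survives some G j (some i) x <;> simp [rivals, hu, hs, huw, hw, hni]
    · simp [rivals, hic, hw, hni, setEdge_of_ne _ _ (.inr hic)]
  · have : x ∈ rivals j (setEdge G u c (G w c)) w i ↔ x ∈ rivals j G w i := by
      simp only [rivals, mem_filter, mem_univ, true_and, hw, setEdge_of_ne _ _ (.inl hxu)]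
      refine and_congr_right fun hxw => and_congr_right fun hG => ?_
      obtain ⟨h3, h4⟩ := h₁ i (by simp) x hxw hG
      exact survives_setEdge huw j _ x (some i) (by simp) (by simp) (by simp) hxw
        (fun h => absurd h hxu) h4
    rw [this]
    split_ifs <;> simp [hxu]

end Redirect

/-! ### Concentration for functions of independent choices -/

section Concentration

/-- The linear term vanishes on averaging a centred variable, which leaves a sub-Gaussian bound. -/
lemma exp_le_add_exp_sq (x : ℝ) : Real.exp x ≤ x + Real.exp (x ^ 2) := by
  have h2 := Real.add_one_le_exp (x ^ 2)
  rcases le_or_gt |x| 1 with h | h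
  · have := (abs_le.1 (Real.abs_exp_sub_one_sub_id_le h)).2
    linarith
  · rcases lt_abs.1 h with h | h
    · have : Real.exp x ≤ Real.exp (x ^ 2) := Real.exp_le_exp.2 (by nlinarith)
      linarith
    · have : Real.exp x ≤ 1 := Real.exp_le_one_iff.2 (by linarith)
      nlinarith

variable {α : Type*} [Fintype α]

lemma abs_sub_expect_le [Nonempty α] {h : α → ℝ} {L : ℝ} (a : α) (hL : ∀ b, |h a - h b| ≤ L) :
    |h a - 𝔼 b, h b| ≤ L := by
  have : h a - 𝔼 b, h b = 𝔼 b, (h a - h b) := by simp [expect_sub_distrib]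
  rw [this]
  exact (abs_expect_le _ _).trans (expect_le univ_nonempty fun b _ => hL b)

lemma expect_exp_centered_le [Nonempty α] {h : α → ℝ} {L : ℝ} (hL : ∀ a b, |h a - h b| ≤ L)
    (s : ℝ) : 𝔼 a, Real.exp (s * (h a - 𝔼 b, h b)) ≤ Real.exp ((s * L) ^ 2) := by
  calc 𝔼 a, Real.exp (s * (h a - 𝔼 b, h b))
      ≤ 𝔼 a, (s * (h a - 𝔼 b, h b) + Real.exp ((s * L) ^ 2)) := by
        refine expect_le_expect fun a _ => (exp_le_add_exp_sq _).trans ?_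
        gcongr 1
        refine Real.exp_le_exp.2 (sq_le_sq.2 ?_)
        rw [abs_mul, abs_mul]
        exact mul_le_mul_of_nonneg_left
          ((abs_sub_expect_le a (hL a)).trans (le_abs_self L)) (abs_nonneg s)
    _ = _ := by
        rw [expect_add_distrib, ← mul_expect, expect_sub_distrib]
        simp

lemma expect_fin_cons (n : ℕ) (F : (Fin (n + 1) → α) → ℝ) :
    𝔼 x, F x = 𝔼 a, 𝔼 y : Fin n → α, F (Fin.cons a y : Fin (n + 1) → α) :=
  (Fintype.expect_equiv (Fin.consEquiv fun _ : Fin (n + 1) => α) (fun p => F (Fin.cons p.1 p.2)) F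
    fun _ => rfl).symm.trans
    (expect_product' univ univ fun a (y : Fin n → α) => F (Fin.cons a y : Fin (n + 1) → α))

/-- The martingale argument, as an induction on coordinates: the conditional mean `g` given the
first coordinate oscillates by at most `|L|`, and for each fixed value of it the function is again
Lipschitz in the other coordinates. -/
lemma expect_exp_lipschitz_le [Nonempty α] (L s : ℝ) (n : ℕ) :
    ∀ F : (Fin n → α) → ℝ, (∀ x y, |F x - F y| ≤ L * hammingDist x y) →
      𝔼 x, Real.exp (s * (F x - 𝔼 y, F y)) ≤ Real.exp (n * (s * L) ^ 2) := by
  induction n with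
  | zero =>
    intro F _
    simp
  | succ n ih =>
    intro F hF
    have hdist : ∀ (a b : α) (y z : Fin n → α), hammingDist (Fin.cons a y : Fin (n + 1) → α)
        (Fin.cons b z : Fin (n + 1) → α) = (if a = b then 0 else 1) + hammingDist y z := by
      intro a b y z
      simp only [hammingDist, Fin.card_filter_univ_succ]
      by_cases h : a = b <;> simp [h, add_comm]
    let g : α → ℝ := fun a => 𝔼 y : Fin n → α, F (Fin.cons a y : Fin (n + 1) → α)
    have hL : 0 ≤ L ∨ ∀ a b : α, a = b := by
      by_contra! h
      obtain ⟨h, a, b, hab⟩ := h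
      have := (abs_nonneg _).trans (hF (Fin.cons a fun _ => a) (Fin.cons b fun _ => a))
      rw [hdist] at this
      simp [hab] at this
      linarith
    have hg : ∀ a b, |g a - g b| ≤ |L| := by
      intro a b
      simp only [g]
      rw [← expect_sub_distrib]
      refine (abs_expect_le _ _).trans (expect_le univ_nonempty fun y _ => ?_)
      refine (hF _ _).trans ?_
      rw [hdist]
      by_cases h : a = b <;> simp [h, le_abs_self]
    rw [expect_fin_cons, expect_fin_cons n F]
    calc 𝔼 a, 𝔼 y : Fin n → α, Real.exp (s * (F (Fin.cons a y : Fin (n + 1) → α) - 𝔼 b, g b))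
        = 𝔼 a, Real.exp (s * (g a - 𝔼 b, g b)) * 𝔼 y : Fin n → α,
            Real.exp (s * (F (Fin.cons a y : Fin (n + 1) → α) - g a)) := by
          refine expect_congr rfl fun a _ => ?_
          rw [mul_expect]
          refine expect_congr rfl fun y _ => ?_
          rw [← Real.exp_add]
          ring_nf
      _ ≤ 𝔼 a, Real.exp (s * (g a - 𝔼 b, g b)) * Real.exp (n * (s * L) ^ 2) := by
          refine expect_le_expect fun a _ => mul_le_mul_of_nonneg_left ?_ (Real.exp_nonneg _)
          refine ih _ fun y z => (hF _ _).trans (le_of_eq ?_)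
          rw [hdist]
          simp
      _ = (𝔼 a, Real.exp (s * (g a - 𝔼 b, g b))) * Real.exp (n * (s * L) ^ 2) :=
          (expect_mul _ _ _).symm
      _ ≤ Real.exp ((s * |L|) ^ 2) * Real.exp (n * (s * L) ^ 2) :=
          mul_le_mul_of_nonneg_right (expect_exp_centered_le hg s) (Real.exp_nonneg _)
      _ = _ := by
          rw [← Real.exp_add, mul_pow, sq_abs]
          push_cast
          ring_nf

lemma prob_le_expect_exp (X : α → ℝ) (s t : ℝ) (hs : 0 ≤ s) :
    prob (fun a => t < X a) ≤ Real.exp (-(s * t)) * 𝔼 a, Real.exp (s * X a) := by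
  rw [mul_expect]
  refine expect_le_expect fun a _ => ?_
  rw [← Real.exp_add]
  split_ifs with h
  · refine Real.one_le_exp ?_
    nlinarith
  · exact Real.exp_nonneg _

lemma prob_lipschitz_deviation_le [Nonempty α] {L : ℝ} (hL : 0 < L) {n : ℕ} (hn : 0 < n)
    {F : (Fin n → α) → ℝ} (hF : ∀ x y, |F x - F y| ≤ L * hammingDist x y) {t : ℝ} (ht : 0 ≤ t) :
    prob (fun x => t < |F x - 𝔼 y, F y|) ≤ 2 * Real.exp (-(t ^ 2 / (4 * n * L ^ 2))) := by
  have hn' : (0 : ℝ) < n := by exact_mod_cast hn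
  have one_sided : ∀ F : (Fin n → α) → ℝ, (∀ x y, |F x - F y| ≤ L * hammingDist x y) →
      prob (fun x => t < F x - 𝔼 y, F y) ≤ Real.exp (-(t ^ 2 / (4 * n * L ^ 2))) := by
    intro F hF
    -- This value of `s` minimises the exponent `n s² L² - s t`.
    refine (prob_le_expect_exp _ (t / (2 * n * L ^ 2)) t (by positivity)).trans ?_
    refine (mul_le_mul_of_nonneg_left (expect_exp_lipschitz_le L _ n F hF)
      (Real.exp_nonneg _)).trans (le_of_eq ?_)
    rw [← Real.exp_add]
    congr 1
    field_simp
    ring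
  have h2 := one_sided (fun x => -F x) fun x y => by
    rw [← abs_neg]; convert hF x y using 2; ring
  refine (prob_mono (Q := fun x => t < F x - 𝔼 y, F y ∨ t < -F x - 𝔼 y, -F y) ?_).trans ?_
  · intro x hx
    rw [expect_neg_distrib]
    rcases lt_abs.1 hx with h | h
    · exact .inl h
    · exact .inr (by linarith)
  · exact (prob_or_le _ _).trans (by linarith [one_sided F hF])

/-- Away from the good set `A` the function is replaced by a Lipschitz extension, clamped to `[0,
B]` so that the two means differ by at most `B` times the probability of leaving `A`. -/
lemma prob_not_lt_deviation_le [Nonempty α] {L B : ℝ} (hL : 0 < L) (hB : 0 ≤ B) {n : ℕ}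
    (hn : 0 < n) {F : (Fin n → α) → ℝ} (hF0 : ∀ x, 0 ≤ F x) (hFB : ∀ x, F x ≤ B)
    (A : (Fin n → α) → Prop)
    (hF : ∀ x y, A x → A y → |F x - F y| ≤ L * hammingDist x y) {t : ℝ} (ht : 0 ≤ t) :
    prob (fun x => t + B * prob (fun y => ¬ A y) < |F x - 𝔼 y, F y|) ≤
      prob (fun y => ¬ A y) + 2 * Real.exp (-(t ^ 2 / (4 * n * L ^ 2))) := by
  have hlip : LipschitzOnWith ⟨L, hL.le⟩ (fun x : Hamming fun _ : Fin n => α => F (Hamming.ofHamming x))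
      {x | A (Hamming.ofHamming x)} :=
    LipschitzOnWith.of_dist_le_mul fun x hx y hy => by
      rw [Real.dist_eq, Hamming.dist_eq_hammingDist]
      exact hF _ _ hx hy
  obtain ⟨g, hg, hgF⟩ := hlip.extend_real
  have hg' := (hg.const_min B).const_max 0
  let H : (Fin n → α) → ℝ := fun x => max 0 (min B (g (Hamming.toHamming x)))
  have hH : ∀ x y, |H x - H y| ≤ L * hammingDist x y := fun x y => by
    have := hg'.dist_le_mul (Hamming.toHamming x) (Hamming.toHamming y)
    rwa [Real.dist_eq, Hamming.dist_eq_hammingDist] at this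
  have hHF : ∀ x, A x → H x = F x := fun x hx => by
    have : F x = g (Hamming.toHamming x) := hgF (x := Hamming.toHamming x) hx
    simp only [H, ← this, min_eq_right (hFB x), max_eq_right (hF0 x)]
  have hdiff : |(𝔼 x, H x) - 𝔼 x, F x| ≤ B * prob (fun y => ¬ A y) := by
    rw [← expect_sub_distrib, prob, mul_expect]
    refine (abs_expect_le _ _).trans (expect_le_expect fun x _ => ?_)
    by_cases hx : A x
    · simp [hx, hHF x hx]
    · simp only [hx, not_false_eq_true, if_true, mul_one]
      have h1 : 0 ≤ H x := le_max_left _ _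
      have h2 : H x ≤ B := max_le hB (min_le_left _ _)
      rw [abs_le]
      constructor <;> linarith [hF0 x, hFB x]
  refine (prob_mono (Q := fun x => ¬ A x ∨ t < |H x - 𝔼 y, H y|) fun x hx => ?_).trans
    ((prob_or_le _ _).trans (add_le_add_right (prob_lipschitz_deviation_le hL hn hH ht) _))
  by_cases hA : A x
  · right
    rw [hHF x hA]
    have := abs_sub_le (F x) (𝔼 y, H y) (𝔼 y, F y)
    linarith
  · exact .inl hA

end Concentration

/-! ### Graphs of bounded degree -/

/-- A node whose status changes at level `j + 1` is itself altered, or shares in `G` the old or the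
new check node of an altered node, or shares a check node with a node whose status changes at level
`j`. These four sources give the factor `4dy`. Only degrees in `G` enter. Quantifying over all `o`
makes the induction independent of `nxt`. -/
lemma card_survivors_sub_le {nxt : Fin d → Option (Fin d)} {y : ℝ} (hy : 1 ≤ y) (hd : 1 ≤ d)
    {G G' : BinsGraph k f} (hG : ∀ i x, (#{u | G u i = x} : ℝ) ≤ y) (j : ℕ) :
    (#{v | ∃ o, ¬ (survives nxt G j o v ↔ survives nxt G' j o v)} : ℝ) ≤
      (4 * d * y) ^ j * hammingDist G G' := by
  have hd' : (1 : ℝ) ≤ d := by exact_mod_cast hd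
  have hdy : (1 : ℝ) ≤ d * y := one_le_mul_of_one_le_of_one_le hd' hy
  induction j with
  | zero => simp [survives]
  | succ j ih =>
    set D : Finset (Fin k) := {v | G v ≠ G' v} with hD
    set E : Finset (Fin k) := {v | ∃ o, ¬ (survives nxt G j o v ↔ survives nxt G' j o v)} with hE
    have hDc : hammingDist G G' = #D := by simp only [hammingDist, hD]
    let nb : (x : Fin k) → Finset (Fin k) := fun x => univ.biUnion fun i => {v | G v i = G x i}
    let nb' : (x : Fin k) → Finset (Fin k) := fun x => univ.biUnion fun i => {v | G v i = G' x i}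
    have hnb : ∀ x, (#(nb x) : ℝ) ≤ d * y := fun x => by
      refine (Nat.cast_le.2 card_biUnion_le).trans ?_
      push_cast
      refine (sum_le_card_nsmul _ _ y fun i _ => hG i _).trans (by simp)
    have hnb' : ∀ x, (#(nb' x) : ℝ) ≤ d * y := fun x => by
      refine (Nat.cast_le.2 card_biUnion_le).trans ?_
      push_cast
      refine (sum_le_card_nsmul _ _ y fun i _ => hG i _).trans (by simp)
    have hbU : ∀ (S : Finset (Fin k)) (N : Fin k → Finset (Fin k)), (∀ x, (#(N x) : ℝ) ≤ d * y) →
        (#(S.biUnion N) : ℝ) ≤ #S * (d * y) := fun S N hN => by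
      refine (Nat.cast_le.2 card_biUnion_le).trans ?_
      push_cast
      refine (sum_le_card_nsmul _ _ (d * y) fun i _ => hN i).trans (by simp)
    have hsub : ({v | ∃ o, ¬ (survives nxt G (j + 1) o v ↔ survives nxt G' (j + 1) o v)} :
        Finset (Fin k)) ⊆ D ∪ (D.biUnion nb ∪ (D.biUnion nb' ∪ E.biUnion nb)) := by
      intro v hv
      by_contra hv'
      simp only [mem_union, mem_biUnion, nb, nb', mem_univ, true_and, mem_filter, not_or,
        not_exists, not_and] at hv'
      obtain ⟨h1, h2, h3, h4⟩ := hv'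
      have hvv : G v = G' v := by simpa [hD] using h1
      simp only [mem_filter, mem_univ, true_and] at hv
      obtain ⟨o, hv⟩ := hv
      refine hv (forall_congr' fun i => imp_congr_right fun _ => exists_congr fun x =>
        and_congr_right fun _ => ?_)
      by_cases hx : x ∈ D
      · rw [← hvv]
        exact ⟨fun h => absurd h.1.symm (h2 x hx i), fun h => absurd h.1.symm (h3 x hx i)⟩
      · have hxx : G x = G' x := by simpa [hD] using hx
        rw [← hvv, ← hxx]
        refine and_congr_right fun hxv => ?_
        by_contra hs
        exact h4 x (by simp only [hE, mem_filter, mem_univ, true_and]; exact ⟨_, hs⟩) i hxv.symm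
    have hcard := (card_le_card hsub).trans ((card_union_le _ _).trans (add_le_add_right
      ((card_union_le _ _).trans (add_le_add_right (card_union_le _ _) _)) _))
    have hcard' : (#{v | ∃ o, ¬ (survives nxt G (j + 1) o v ↔ survives nxt G' (j + 1) o v)} : ℝ) ≤
        #D + (#D * (d * y) + (#D * (d * y) + #E * (d * y))) := by
      refine (Nat.cast_le.2 hcard).trans ?_
      push_cast
      have := hbU D nb hnb
      have := hbU D nb' hnb'
      have := hbU E nb hnb
      linarith
    refine hcard'.trans ?_
    rw [hDc] at ih ⊢
    have hz : (1 : ℝ) ≤ (4 * d * y) ^ j := one_le_pow₀ (by nlinarith)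
    have hD0 : (0 : ℝ) ≤ #D := Nat.cast_nonneg _
    have e1 : (#E : ℝ) * (d * y) ≤ (4 * d * y) ^ j * #D * (d * y) :=
      mul_le_mul_of_nonneg_right ih (by linarith)
    have e2 : (#D : ℝ) * (d * y) ≤ (4 * d * y) ^ j * (#D * (d * y)) :=
      le_mul_of_one_le_left (by positivity) hz
    have e3 : (#D : ℝ) ≤ #D * (d * y) := le_mul_of_one_le_right hD0 hdy
    calc (#D : ℝ) + (#D * (d * y) + (#D * (d * y) + #E * (d * y)))
        ≤ 4 * ((4 * d * y) ^ j * (#D * (d * y))) := by linarith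
      _ = _ := by ring

lemma abs_survivors_sub_le {nxt : Fin d → Option (Fin d)} {y : ℝ} (hy : 1 ≤ y) (hd : 1 ≤ d)
    {G G' : BinsGraph k f} (hG : ∀ i x, (#{u | G u i = x} : ℝ) ≤ y) (j : ℕ)
    (o : Option (Fin d)) :
    |(survivors nxt j o G : ℝ) - survivors nxt j o G'| ≤ (4 * d * y) ^ j * hammingDist G G' := by
  refine le_trans ?_ (card_survivors_sub_le (nxt := nxt) (G' := G') hy hd hG j)
  have key : ∀ A B E : Finset (Fin k), A \ B ⊆ E → (#A : ℝ) ≤ #B + #E := fun A B E h => by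
    have := card_le_card_sdiff_add_card (s := A) (t := B)
    have := card_le_card h
    norm_cast
    omega
  rw [abs_le]
  unfold survivors
  constructor
  · have := key {v | survives nxt G' j o v} {v | survives nxt G j o v}
      {v | ∃ o, ¬ (survives nxt G j o v ↔ survives nxt G' j o v)} fun v hv => by
        simp only [Finset.mem_sdiff, mem_filter, mem_univ, true_and] at hv ⊢
        exact ⟨o, fun h => hv.2 (h.2 hv.1)⟩
    linarith
  · have := key {v | survives nxt G j o v} {v | survives nxt G' j o v}
      {v | ∃ o, ¬ (survives nxt G j o v ↔ survives nxt G' j o v)} fun v hv => by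
        simp only [Finset.mem_sdiff, mem_filter, mem_univ, true_and] at hv ⊢
        exact ⟨o, fun h => hv.2 (h.1 hv.1)⟩
    linarith

lemma expect_pi_apply (hf : ∀ i, f i ≠ 0) (i : Fin d) (φ : Fin (f i) → ℝ) :
    𝔼 a : (i : Fin d) → Fin (f i), φ (a i) = 𝔼 x, φ x := by
  have hne : ∀ i, Nonempty (Fin (f i)) := fun i => ⟨⟨0, Nat.pos_of_ne_zero (hf i)⟩⟩
  -- The marginal is read off from the ensemble with a single variable node.
  have h1 := expect_setEdge (k := 1) 0 (hf i) fun G => φ (G 0 i)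
  simp only [setEdge_self] at h1
  rw [Fintype.expect_const] at h1
  rw [← h1]
  exact Fintype.expect_equiv (Equiv.funUnique (Fin 1) _).symm _ _ fun a => rfl

/-- The degree is a sum of independent indicators, so its exponential moment is `(1 + (e - 1) / f i)
^ k`, at most `exp (2 k / f i)`. -/
lemma prob_degree_le (hf : ∀ i, f i ≠ 0) (i : Fin d) (x : Fin (f i)) (y : ℝ) :
    prob (fun G : BinsGraph k f => y < #{u | G u i = x}) ≤
      Real.exp (-y + 2 * (k / f i)) := by
  have hne : ∀ i, Nonempty (Fin (f i)) := fun i => ⟨⟨0, Nat.pos_of_ne_zero (hf i)⟩⟩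
  have hfi : (0 : ℝ) < f i := by exact_mod_cast Nat.pos_of_ne_zero (hf i)
  refine (prob_le_expect_exp _ 1 y zero_le_one).trans ?_
  rw [one_mul, Real.exp_add]
  refine mul_le_mul_of_nonneg_left ?_ (Real.exp_nonneg _)
  have hprod : ∀ G : BinsGraph k f, Real.exp (1 * #{u | G u i = x}) =
      ∏ u, if G u i = x then Real.exp 1 else 1 := fun G => by
    rw [prod_ite, prod_const, prod_const_one, mul_one, one_mul, ← Real.exp_nat_mul, mul_one]
  simp only [hprod]
  have hpow := expect_pow (univ : Finset ((i : Fin d) → Fin (f i)))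
    (fun a => if a i = x then Real.exp 1 else 1) k
  rw [Fintype.piFinset_univ] at hpow
  rw [← hpow, expect_pi_apply hf i fun z => if z = x then Real.exp 1 else 1]
  have hmean : 𝔼 z : Fin (f i), (if z = x then Real.exp 1 else 1) = 1 + (Real.exp 1 - 1) / f i := by
    have : ∀ z : Fin (f i), (if z = x then Real.exp 1 else 1) =
        1 + if z = x then Real.exp 1 - 1 else 0 := fun z => by split_ifs <;> ring
    simp only [this]
    rw [expect_add_distrib, Fintype.expect_const, Fintype.expect_eq_sum_div_card]
    simp
  rw [hmean]
  have he : Real.exp 1 - 1 ≤ 2 := by linarith [Real.exp_one_lt_d9]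
  calc (1 + (Real.exp 1 - 1) / f i) ^ k ≤ (Real.exp (2 / f i)) ^ k := by
        have h1 : 1 ≤ Real.exp 1 := Real.one_le_exp zero_le_one
        refine pow_le_pow_left₀ (by have := sub_nonneg.2 h1; positivity) ?_ k
        have := Real.add_one_le_exp (2 / (f i : ℝ))
        have : (Real.exp 1 - 1) / f i ≤ 2 / f i := by gcongr
        linarith
    _ = _ := by rw [← Real.exp_nat_mul]; ring_nf

lemma prob_exists_degree_le (hf : ∀ i, f i ≠ 0) (y : ℝ) :
    prob (fun G : BinsGraph k f => ¬ ∀ i x, (#{u | G u i = x} : ℝ) ≤ y) ≤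
      ∑ i, f i * Real.exp (-y + 2 * (k / f i)) := by
  calc prob (fun G : BinsGraph k f => ¬ ∀ i x, (#{u | G u i = x} : ℝ) ≤ y)
      ≤ prob (fun G : BinsGraph k f =>
          ∃ i ∈ univ, ∃ x ∈ (univ : Finset (Fin (f i))), y < #{u | G u i = x}) := by
        refine prob_mono fun G hG => ?_
        push Not at hG
        obtain ⟨i, x, h⟩ := hG
        exact ⟨i, mem_univ _, x, mem_univ _, h⟩
    _ ≤ ∑ i, prob (fun G : BinsGraph k f =>
          ∃ x ∈ (univ : Finset (Fin (f i))), y < #{u | G u i = x}) := prob_exists_le _ _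
    _ ≤ _ := by
        refine sum_le_sum fun i _ => (prob_exists_le univ
          fun x (G : BinsGraph k f) => y < #{u | G u i = x}).trans ?_
        refine (sum_le_card_nsmul _ _ _ fun x _ => prob_degree_le hf i x y).trans ?_
        simp

/-! ### The asymptotic regime -/

/-- The regime `k → ∞`, uniformly in the class sizes `f i` with `|f i - η k| ≤ C`. -/
def regime (d : ℕ) (η C : ℝ) : Filter (ℕ × (Fin d → ℕ)) :=
  comap Prod.fst atTop ⊓ 𝓟 {p | ∀ i, |(p.2 i : ℝ) - η * p.1| ≤ C}

lemma eventually_regime_iff {η C : ℝ} {P : ℕ × (Fin d → ℕ) → Prop} :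
    (∀ᶠ p in regime d η C, P p) ↔
      ∃ K : ℕ, ∀ k, K ≤ k → ∀ f : Fin d → ℕ, (∀ i, |(f i : ℝ) - η * k| ≤ C) → P (k, f) := by
  simp only [regime, eventually_inf_principal, eventually_comap, eventually_atTop, Set.mem_ofPred_eq]
  constructor
  · rintro ⟨K, h⟩
    exact ⟨K, fun k hk f hf => h k hk (k, f) rfl hf⟩
  · rintro ⟨K, h⟩
    refine ⟨K, ?_⟩
    rintro _ hk ⟨k, f⟩ rfl hf
    exact h k hk f hf

lemma tendsto_regime_fst (d : ℕ) (η C : ℝ) :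
    Tendsto (fun p : ℕ × (Fin d → ℕ) => (p.1 : ℝ)) (regime d η C) atTop :=
  tendsto_natCast_atTop_atTop.comp (tendsto_comap.mono_left inf_le_left)

lemma eventually_regime_abs_le (d : ℕ) (η C : ℝ) :
    ∀ᶠ p in regime d η C, ∀ i, |(p.2 i : ℝ) - η * p.1| ≤ C :=
  eventually_regime_iff.2 ⟨0, fun _ _ _ hf => hf⟩

lemma eventually_regime_bounds {η : ℝ} (hη : 0 < η) (C : ℝ) :
    ∀ᶠ p in regime d η C, ∀ i, η / 2 * p.1 ≤ p.2 i ∧ (p.2 i : ℝ) ≤ 2 * η * p.1 := by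
  filter_upwards [eventually_regime_abs_le d η C,
    (tendsto_regime_fst d η C).eventually_ge_atTop (C / (η / 2))] with p hp hC i
  rw [div_le_iff₀ (by positivity)] at hC
  have := abs_le.1 (hp i)
  have h0 : (0 : ℝ) ≤ η * p.1 := by positivity
  constructor <;> nlinarith

lemma tendsto_regime_ratio {η : ℝ} (hη : 0 < η) (C : ℝ) (i : Fin d) :
    Tendsto (fun p : ℕ × (Fin d → ℕ) => (p.1 : ℝ) / p.2 i) (regime d η C) (𝓝 (1 / η)) := by
  have h : Tendsto (fun p : ℕ × (Fin d → ℕ) => (p.2 i : ℝ) / p.1) (regime d η C) (𝓝 η) := by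
    rw [tendsto_iff_norm_sub_tendsto_zero]
    have h0 : Tendsto (fun p : ℕ × (Fin d → ℕ) => C / (p.1 : ℝ)) (regime d η C) (𝓝 0) :=
      (tendsto_regime_fst d η C).const_div_atTop C
    refine squeeze_zero' (.of_forall fun _ => norm_nonneg _) ?_ h0
    filter_upwards [eventually_regime_abs_le d η C,
      (tendsto_regime_fst d η C).eventually_gt_atTop 0] with p hp h0
    rw [Real.norm_eq_abs, show (p.2 i : ℝ) / p.1 - η = (p.2 i - η * p.1) / p.1 by field_simp,
      abs_div, abs_of_pos h0]
    exact div_le_div_of_nonneg_right (hp i) h0.le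
  simpa using h.inv₀ hη.ne'

lemma survivors_le (nxt : Fin d → Option (Fin d)) (j : ℕ) (o : Option (Fin d))
    (G : BinsGraph k f) : (survivors nxt j o G : ℝ) ≤ k := by
  have : survivors nxt j o G ≤ k := (card_le_univ _).trans (by simp)
  exact_mod_cast this

lemma abs_survivors_sub_expect_le (nxt : Fin d → Option (Fin d)) (j : ℕ) (o : Option (Fin d))
    (G : BinsGraph k f) :
    |(survivors nxt j o G : ℝ) - 𝔼 G' : BinsGraph k f, (survivors nxt j o G' : ℝ)| ≤ k := by
  have : Nonempty (BinsGraph k f) := ⟨G⟩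
  refine abs_sub_expect_le (h := fun G : BinsGraph k f => (survivors nxt j o G : ℝ)) G
    fun G' => ?_
  rw [abs_le]
  constructor <;> linarith [survivors_le nxt j o G, survivors_le nxt j o G',
    Nat.cast_nonneg (α := ℝ) (survivors nxt j o G), Nat.cast_nonneg (α := ℝ) (survivors nxt j o G')]

/-- The number of survivors is concentrated around its mean. -/
theorem exists_prob_survivors_deviation_lt (hd : 1 ≤ d) {η : ℝ} (hη : 0 < η) (j : ℕ) :
    ∃ β : ℝ, 0 < β ∧ ∀ (nxt : Fin d → Option (Fin d)) (C ε : ℝ), 0 < ε →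
      ∀ᶠ p in regime d η C, ∀ o,
        prob (fun G : BinsGraph p.1 p.2 => p.1 * ε <
          |(survivors nxt j o G : ℝ) - 𝔼 G' : BinsGraph p.1 p.2, (survivors nxt j o G' : ℝ)|) <
        Real.exp (-(β * ε ^ 2 * (p.1 : ℝ) ^ ((1 : ℝ) / (4 * (j : ℝ) + 1)))) := by
  have hd' : (1 : ℝ) ≤ d := by exact_mod_cast hd
  -- With `t = kε/2`, `L = (4dy)^j` and `k = y^(4j+1)`, the exponent `t² / (4kL²)` equals `2βε² y ·
  -- y^(2j)`. The spare factor 2 absorbs multiplicative constants.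
  set β : ℝ := 1 / (32 * (4 * d) ^ (2 * j)) with hβ
  have hβ0 : 0 < β := by positivity
  have hβ1 : β ≤ 1 / 2 := by
    rw [hβ]
    refine one_div_le_one_div_of_le (by norm_num) ?_
    have : (1 : ℝ) ≤ (4 * d) ^ (2 * j) := one_le_pow₀ (by linarith)
    linarith
  refine ⟨β, hβ0, fun nxt C ε hε => ?_⟩
  -- For `ε ≥ 1` the event is empty, as deviations never exceed `k`. For `ε < 1` the degree tail, of
  -- order `exp (-y)` up to powers of `y`, is smaller than the target.
  rcases le_or_gt 1 ε with hε1 | hε1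
  · filter_upwards with p o
    have : prob (fun G : BinsGraph p.1 p.2 => p.1 * ε <
        |(survivors nxt j o G : ℝ) - 𝔼 G' : BinsGraph p.1 p.2, (survivors nxt j o G' : ℝ)|) ≤ 0 := by
      refine (expect_le_expect (g := fun _ => (0 : ℝ)) fun G _ => ?_).trans (by simp)
      have h1 := abs_survivors_sub_expect_le nxt j o G
      have h2 : (p.1 : ℝ) ≤ p.1 * ε := le_mul_of_one_le_right (Nat.cast_nonneg _) hε1
      rw [if_neg (by linarith)]
    exact this.trans_lt (Real.exp_pos _)
  set c : ℝ := d * (2 * η * Real.exp (4 / η)) with hc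
  have hc0 : 0 < c := by positivity
  have hy : Tendsto (fun p : ℕ × (Fin d → ℕ) => (p.1 : ℝ) ^ ((1 : ℝ) / (4 * (j : ℝ) + 1)))
      (regime d η C) atTop :=
    (tendsto_rpow_atTop (by positivity)).comp (tendsto_regime_fst d η C)
  have hexp : Tendsto (fun y : ℝ => c * (y ^ (4 * j + 1) * Real.exp (-(y / 2)))) atTop (𝓝 0) := by
    have h := (Real.tendsto_pow_mul_exp_neg_atTop_nhds_zero (4 * j + 1)).comp
      (tendsto_id.atTop_div_const (zero_lt_two (α := ℝ)))
    have := h.const_mul (c * 2 ^ (4 * j + 1))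
    simp only [mul_zero] at this
    refine this.congr fun y => ?_
    simp only [Function.comp, id, div_pow]
    field_simp
  have hexp' : Tendsto (fun y : ℝ => Real.exp (-(β * ε ^ 2 * y))) atTop (𝓝 0) :=
    Real.tendsto_exp_neg_atTop_nhds_zero.comp (tendsto_id.const_mul_atTop (by positivity))
  filter_upwards [eventually_regime_bounds hη C, (tendsto_regime_fst d η C).eventually_gt_atTop 0,
    hy.eventually_ge_atTop 1, hy.eventually (hexp.eventually_lt_const (half_pos hε)),
    hy.eventually (hexp.eventually_lt_const (one_half_pos (α := ℝ))),
    hy.eventually (hexp'.eventually_lt_const (show (0 : ℝ) < 1 / 4 by norm_num))]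
    with p hf hk hy1 h1 h2 h3 o
  obtain ⟨k, f⟩ := p
  simp only at hf hk hy1 h1 h2 h3 ⊢
  set y : ℝ := (k : ℝ) ^ ((1 : ℝ) / (4 * (j : ℝ) + 1)) with hydef
  have hky : (k : ℝ) = y ^ (4 * j + 1) := by
    rw [hydef, ← Real.rpow_natCast, ← Real.rpow_mul hk.le]
    push_cast
    rw [one_div, inv_mul_cancel₀ (by positivity), Real.rpow_one]
  have hk' : 0 < k := by exact_mod_cast hk
  have hfpos : ∀ i, (0 : ℝ) < f i := fun i => lt_of_lt_of_le (by positivity) (hf i).1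
  have hf0 : ∀ i, f i ≠ 0 := fun i h => by simpa [h] using hfpos i
  have hne : ∀ i, Nonempty (Fin (f i)) := fun i => ⟨⟨0, Nat.pos_of_ne_zero (hf0 i)⟩⟩
  set q : ℝ := prob (fun G : BinsGraph k f => ¬ ∀ i x, (#{u | G u i = x} : ℝ) ≤ y) with hq
  -- Half of the exponent absorbs the polynomial number of check nodes; the other half is compared
  -- with the target bound.
  have hq1 : q ≤ c * (y ^ (4 * j + 1) * Real.exp (-(y / 2))) * Real.exp (-(y / 2)) := by
    refine (prob_exists_degree_le hf0 y).trans ?_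
    refine (sum_le_card_nsmul _ _ (2 * η * k * (Real.exp (-y) * Real.exp (4 / η)))
      fun i _ => ?_).trans (le_of_eq ?_)
    · rw [Real.exp_add]
      gcongr
      · exact (hf i).2
      · rw [mul_div_assoc', div_le_div_iff₀ (hfpos i) hη]
        nlinarith [(hf i).1]
    · rw [hc, hky, nsmul_eq_mul, card_univ, Fintype.card_fin,
        show -y = -(y / 2) + -(y / 2) by ring, Real.exp_add]
      ring
  have hexpy : Real.exp (-(y / 2)) ≤ 1 := Real.exp_le_one_iff.2 (by linarith)
  have hexp0 : 0 < Real.exp (-(y / 2)) := Real.exp_pos _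
  have hA0 : 0 ≤ c * (y ^ (4 * j + 1) * Real.exp (-(y / 2))) := by positivity
  -- Truncation costs `k q` in the deviation, so `q ≤ ε / 2` leaves `kε / 2` for the Lipschitz part.
  have hq2 : q ≤ ε / 2 := hq1.trans ((mul_le_of_le_one_right hA0 hexpy).trans h1.le)
  have hβε : β * ε ^ 2 * y ≤ y / 2 := by
    have : ε ^ 2 ≤ 1 := pow_le_one₀ hε.le hε1.le
    have : β * ε ^ 2 ≤ 1 / 2 := by nlinarith
    nlinarith
  have hq3 : q ≤ 1 / 2 * Real.exp (-(β * ε ^ 2 * y)) := by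
    refine hq1.trans (mul_le_mul h2.le ?_ hexp0.le (by norm_num))
    exact Real.exp_le_exp.2 (by linarith)
  have hLpos : (0 : ℝ) < (4 * d * y) ^ j := by positivity
  have hdev := prob_not_lt_deviation_le (α := (i : Fin d) → Fin (f i)) hLpos hk.le hk'
    (F := fun G : BinsGraph k f => (survivors nxt j o G : ℝ)) (fun _ => Nat.cast_nonneg _)
    (fun G => survivors_le nxt j o G) (fun G => ∀ i x, (#{u | G u i = x} : ℝ) ≤ y)
    (fun G G' hG _ => by
      convert abs_survivors_sub_le hy1 hd hG j o) (t := k * (ε / 2)) (by positivity)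
  have hexponent : 2 * (β * ε ^ 2 * y) ≤ (k * (ε / 2)) ^ 2 / (4 * k * ((4 * d * y) ^ j) ^ 2) := by
    have e : (k * (ε / 2)) ^ 2 / (4 * k * ((4 * d * y) ^ j) ^ 2) =
        2 * (β * ε ^ 2 * y) * y ^ (2 * j) := by
      rw [hβ, hky]
      have : y ≠ 0 := by positivity
      field_simp
      ring
    rw [e]
    exact le_mul_of_one_le_right (by positivity) (one_le_pow₀ hy1)
  have hmain : 2 * Real.exp (-((k * (ε / 2)) ^ 2 / (4 * k * ((4 * d * y) ^ j) ^ 2))) <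
      1 / 2 * Real.exp (-(β * ε ^ 2 * y)) := by
    have : Real.exp (-((k * (ε / 2)) ^ 2 / (4 * k * ((4 * d * y) ^ j) ^ 2))) ≤
        Real.exp (-(β * ε ^ 2 * y)) * Real.exp (-(β * ε ^ 2 * y)) := by
      rw [← Real.exp_add]
      exact Real.exp_le_exp.2 (by linarith)
    nlinarith [Real.exp_pos (-(β * ε ^ 2 * y))]
  refine lt_of_le_of_lt (prob_mono fun G hG => lt_of_le_of_lt ?_ hG)
    (lt_of_le_of_lt hdev (by linarith))
  have : (k : ℝ) * q ≤ k * (ε / 2) := mul_le_mul_of_nonneg_left hq2 hk.le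
  change (k : ℝ) * (ε / 2) + k * q ≤ k * ε
  linarith

/-- The number of survivors is concentrated around its mean in `L¹`. -/
lemma tendsto_expect_abs_survivors_sub (hd : 1 ≤ d) {η : ℝ} (hη : 0 < η) (C : ℝ) (j : ℕ)
    (nxt : Fin d → Option (Fin d)) (o : Option (Fin d)) :
    Tendsto (fun p : ℕ × (Fin d → ℕ) => 𝔼 G : BinsGraph p.1 p.2,
      |(survivors nxt j o G : ℝ) / p.1 -
        𝔼 G' : BinsGraph p.1 p.2, (survivors nxt j o G' : ℝ) / p.1|) (regime d η C) (𝓝 0) := by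
  obtain ⟨β, hβ, H⟩ := exists_prob_survivors_deviation_lt hd hη j
  rw [Metric.tendsto_nhds]
  intro ε hε
  have hε2 := half_pos hε
  have hy : Tendsto (fun p : ℕ × (Fin d → ℕ) => (p.1 : ℝ) ^ ((1 : ℝ) / (4 * (j : ℝ) + 1)))
      (regime d η C) atTop :=
    (tendsto_rpow_atTop (by positivity)).comp (tendsto_regime_fst d η C)
  have hexp : Tendsto (fun y : ℝ => Real.exp (-(β * (ε / 2) ^ 2 * y))) atTop (𝓝 0) :=
    Real.tendsto_exp_neg_atTop_nhds_zero.comp (tendsto_id.const_mul_atTop (by positivity))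
  filter_upwards [H nxt C (ε / 2) hε2, (tendsto_regime_fst d η C).eventually_gt_atTop 0,
    hy.eventually (hexp.eventually_lt_const hε2), eventually_regime_bounds hη C] with p h1 hk h2 hf
  obtain ⟨k, f⟩ := p
  simp only at h1 hk h2 hf ⊢
  have hfpos : ∀ i, (0 : ℝ) < f i := fun i => lt_of_lt_of_le (by positivity) (hf i).1
  have hne : ∀ i, Nonempty (Fin (f i)) := fun i => ⟨⟨0, by exact_mod_cast hfpos i⟩⟩
  rw [Real.dist_eq, sub_zero, abs_of_nonneg (expect_nonneg fun _ _ => abs_nonneg _)]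
  set μ : ℝ := 𝔼 G' : BinsGraph k f, (survivors nxt j o G' : ℝ) with hμ
  calc 𝔼 G : BinsGraph k f, |(survivors nxt j o G : ℝ) / k -
        𝔼 G' : BinsGraph k f, (survivors nxt j o G' : ℝ) / k|
      ≤ 𝔼 G : BinsGraph k f, (ε / 2 + if k * (ε / 2) < |(survivors nxt j o G : ℝ) - μ|
          then 1 else 0) := by
        refine expect_le_expect fun G _ => ?_
        rw [← expect_div, ← hμ, ← sub_div, abs_div, abs_of_pos hk]
        split_ifs with h
        · have h3 := abs_survivors_sub_expect_le nxt j o G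
          have : |(survivors nxt j o G : ℝ) - μ| / k ≤ 1 := (div_le_one hk).2 h3
          linarith
        · rw [add_zero, div_le_iff₀ hk]
          linarith
    _ = ε / 2 + prob (fun G : BinsGraph k f => k * (ε / 2) < |(survivors nxt j o G : ℝ) - μ|) := by
        rw [expect_add_distrib, Fintype.expect_const]
        rfl
    _ < ε / 2 + ε / 2 := by linarith [h1 o]
    _ = ε := by ring

/-! ### The density evolution recursion -/

/-- A function that almost satisfies `ψ' = -a ψ` is almost exponential. -/
lemma abs_sub_exp_le {ψ ψ' : ℝ → ℝ} {a δ : ℝ} (ha : 0 ≤ a)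
    (hψ : ∀ θ, HasDerivAt ψ (ψ' θ) θ) (hb : ∀ θ ∈ Set.Icc (0 : ℝ) 1, |ψ' θ + a * ψ θ| ≤ δ)
    (h0 : ψ 0 = 1) : |ψ 1 - Real.exp (-a)| ≤ δ := by
  -- Integrating factor, normalised to be at most 1 on `[0, 1]`, with `F 1 = ψ 1` and `F 0 = exp
  -- (-a)`.
  let F : ℝ → ℝ := fun θ => Real.exp (a * (θ - 1)) * ψ θ
  have hF : ∀ θ, HasDerivAt F (Real.exp (a * (θ - 1)) * (ψ' θ + a * ψ θ)) θ := fun θ => by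
    have h1 : HasDerivAt (fun θ : ℝ => a * (θ - 1)) a θ := by
      simpa using ((hasDerivAt_id θ).sub_const 1).const_mul a
    exact (h1.exp.mul (hψ θ)).congr_deriv (by ring)
  have := (convex_Icc (0 : ℝ) 1).norm_image_sub_le_of_norm_hasDerivWithin_le (C := δ)
    (fun θ _ => (hF θ).hasDerivWithinAt) (fun θ hθ => ?_) (Set.left_mem_Icc.2 zero_le_one)
    (Set.right_mem_Icc.2 zero_le_one)
  · simpa [F, h0, Real.norm_eq_abs] using this
  · rw [Real.norm_eq_abs, abs_mul, abs_of_pos (Real.exp_pos _)]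
    have h1 : Real.exp (a * (θ - 1)) ≤ 1 := Real.exp_le_one_iff.2 (by nlinarith [hθ.2])
    calc _ ≤ 1 * δ := mul_le_mul h1 (hb θ hθ) (abs_nonneg _) zero_le_one
      _ = δ := one_mul δ

/-- Error term of the density evolution recursion. -/
noncomputable def recursionError (k : ℕ) (f : Fin d → ℕ) (m b : ℝ) (j : ℕ) : ℝ :=
  ∑ i, (k / m * (revisitBound d k m (j + 1) 2 + revisitBound d k m j 2) + 1 / m +
    𝔼 G : BinsGraph k f, |(survivors some j (some i) G : ℝ) / f i - b|)

section Recursion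

variable {m b : ℝ} (hm : 0 < m) (hf : ∀ i, m ≤ f i) (j : ℕ) (w : Fin k) (A : Finset (Fin d))

/-- The number of surviving competitors of `w` at its check nodes with class in `A`. -/
noncomputable def rivalCount (G : BinsGraph k f) : ℕ := ∑ i ∈ A, #(rivals j G w i)

include hm hf in
-- Conditioning on the edge amounts to planting it. Without a short cycle the count in the planted
-- graph, less one, is the count in the original graph. Otherwise both integrands lie in `[0, 1]`,
-- so the error is a probability of `revisits`.
lemma abs_expect_planted_sub_le {θ : ℝ} (h0 : 0 ≤ θ) (h1 : θ ≤ 1) {c : Fin d} (hc : c ∈ A)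
    {u : Fin k} (huw : u ≠ w) :
    |(𝔼 G : BinsGraph k f, if G u c = G w c then (if survives some G j (some c) u then
        θ ^ (rivalCount j w A G - 1) else 0) else 0) -
      (1 / (f c : ℝ)) * 𝔼 G : BinsGraph k f, (if survives some G j (some c) u then
        θ ^ rivalCount j w A G else 0)| ≤
    (1 / m) * (revisitBound d k m (j + 1) 2 + revisitBound d k m j 2) := by
  have hfc : (0 : ℝ) < f c := hm.trans_le (hf c)
  have hf0 : f c ≠ 0 := fun h => by simp [h] at hfc
  rw [expect_edge_eq u hf0 (fun G => G w c) fun G x => setEdge_of_ne _ _ (.inl huw.symm),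
    ← mul_sub, abs_mul, abs_of_pos (one_div_pos.2 hfc)]
  have hpair : #({u, w} : Finset (Fin k)) = 2 := card_pair huw
  refine mul_le_mul (one_div_le_one_div_of_le hm (hf c)) ?_ (abs_nonneg _) (by positivity)
  refine le_trans ?_ (add_le_add
    (hpair ▸ prob_revisits_le hm hf (j + 1) {u, w} w none (by simp))
    (hpair ▸ prob_revisits_le hm hf j {u, w} u (some c) (by simp)))
  refine le_trans ?_ (prob_or_le _ _)
  rw [← expect_sub_distrib]
  refine (abs_expect_le _ _).trans (expect_le_expect fun G _ => ?_)
  have unit : ∀ (P : Prop) (n : ℕ), 0 ≤ (if P then θ ^ n else 0) ∧ (if P then θ ^ n else 0) ≤ 1 :=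
    fun P n => by
      split_ifs
      · exact ⟨pow_nonneg h0 n, pow_le_one₀ h0 h1⟩
      · simp
  by_cases hbad : revisits G (j + 1) {u, w} w none ∨ revisits G j {u, w} u (some c)
  · rw [if_pos hbad, abs_le]
    have := unit (survives some (setEdge G u c (G w c)) j (some c) u)
      (rivalCount j w A (setEdge G u c (G w c)) - 1)
    have := unit (survives some G j (some c) u) (rivalCount j w A G)
    constructor <;> linarith
  · rw [if_neg hbad]
    push Not at hbad
    have hs := survives_setEdge huw j {u, w} u (some c) (by simp) (by simp) (by simp) huw
      (fun _ => rfl) hbad.2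
    by_cases hu : survives some G j (some c) u
    · have hcount : rivalCount j w A (setEdge G u c (G w c)) = rivalCount j w A G + 1 := by
        unfold rivalCount
        have : ∀ i, #(rivals j (setEdge G u c (G w c)) w i) =
            #(rivals j G w i) + if i = c then 1 else 0 := fun i => by
          obtain ⟨h3, h4⟩ := rivals_setEdge huw j hbad.1 hbad.2 i
          rw [h4]
          by_cases hi : i = c
          · rw [if_pos ⟨hi, hu⟩, card_insert_of_notMem h3, if_pos hi]
          · rw [if_neg fun h => hi h.1, if_neg hi, add_zero]
        simp [this, sum_add_distrib, hc]
      simp [hs, hu, hcount]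
    · simp [hs, hu]

include hm hf in
-- Approximate differential equation of the Poisson generating function. The factor `N` is expanded
-- as a sum over rivals, each rival is planted, and the sum over `u` restores the survivor count
-- divided by `f c`, which is close to `b`. Leaving out `w` itself costs `1 / m`.
lemma abs_expect_rivalCount_sub_le {θ : ℝ} (h0 : 0 ≤ θ) (h1 : θ ≤ 1) :
    |(𝔼 G : BinsGraph k f, (rivalCount j w A G : ℝ) * θ ^ (rivalCount j w A G - 1)) -
      (#A * b) * 𝔼 G : BinsGraph k f, θ ^ rivalCount j w A G| ≤ recursionError k f m b j := by
  have hP1 := revisitBound_nonneg hm (Nat.cast_nonneg k) d (j + 1) 2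
  have hP2 := revisitBound_nonneg hm (Nat.cast_nonneg k) d j 2
  set P := revisitBound d k m (j + 1) 2 + revisitBound d k m j 2 with hP
  let X : Fin d → Fin k → ℝ := fun c u => 𝔼 G : BinsGraph k f, if G u c = G w c then
    (if survives some G j (some c) u then θ ^ (rivalCount j w A G - 1) else 0) else 0
  let Y : Fin d → Fin k → ℝ := fun c u => (1 / (f c : ℝ)) * 𝔼 G : BinsGraph k f,
    (if survives some G j (some c) u then θ ^ rivalCount j w A G else 0)
  have hX : 𝔼 G : BinsGraph k f, (rivalCount j w A G : ℝ) * θ ^ (rivalCount j w A G - 1) =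
      ∑ c ∈ A, ∑ u ∈ univ.erase w, X c u := by
    simp only [X]
    simp_rw [← expect_sum_comm]
    refine expect_congr rfl fun G _ => ?_
    conv_lhs => rw [show (rivalCount j w A G : ℝ) = ∑ c ∈ A, (#(rivals j G w c) : ℝ) by
      simp [rivalCount]]
    rw [sum_mul]
    refine sum_congr rfl fun c _ => ?_
    have : rivals j G w c = (univ.erase w).filter
        fun u => G u c = G w c ∧ survives some G j (some c) u := by
      ext u; simp [rivals]
    rw [this, card_filter]
    push_cast
    rw [sum_mul]
    refine sum_congr rfl fun u _ => ?_
    by_cases h1 : G u c = G w c <;> by_cases h2 : survives some G j (some c) u <;> simp [h1, h2]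
  have hY : ∀ c, |(∑ u ∈ univ.erase w, Y c u) - b * 𝔼 G : BinsGraph k f, θ ^ rivalCount j w A G| ≤
      1 / m + 𝔼 G : BinsGraph k f, |(survivors some j (some c) G : ℝ) / f c - b| := by
    intro c
    have hfc : (0 : ℝ) < f c := hm.trans_le (hf c)
    have hne : Nonempty (BinsGraph k f) :=
      ⟨fun _ i => ⟨0, by exact_mod_cast hm.trans_le (hf i)⟩⟩
    have e : (∑ u ∈ univ.erase w, Y c u) = 𝔼 G : BinsGraph k f,
        (((survivors some j (some c) G : ℝ) - if survives some G j (some c) w then 1 else 0) / f c) *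
          θ ^ rivalCount j w A G := by
      simp only [Y]
      rw [← mul_sum, ← expect_sum_comm, mul_expect]
      refine expect_congr rfl fun G _ => ?_
      have : (survivors some j (some c) G : ℝ) - (if survives some G j (some c) w then 1 else 0) =
          ∑ u ∈ univ.erase w, if survives some G j (some c) u then 1 else 0 := by
        rw [sum_erase_eq_sub (mem_univ w), survivors, card_filter]
        push_cast
        rfl
      rw [this, one_div_mul_eq_div, div_mul_eq_mul_div, sum_mul]
      congr 1
      refine sum_congr rfl fun u _ => ?_
      split_ifs <;> simp
    rw [e, mul_expect, ← expect_sub_distrib]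
    refine (abs_expect_le _ _).trans ?_
    rw [← Fintype.expect_const (ι := BinsGraph k f) (1 / m), ← expect_add_distrib]
    refine expect_le_expect fun G _ => ?_
    rw [← sub_mul, abs_mul, abs_of_nonneg (pow_nonneg h0 _)]
    refine (mul_le_of_le_one_right (abs_nonneg _) (pow_le_one₀ h0 h1)).trans ?_
    have hi : |(if survives some G j (some c) w then (1 : ℝ) else 0) / f c| ≤ 1 / m := by
      rw [abs_div, abs_of_pos hfc]
      exact div_le_div₀ zero_le_one (by split_ifs <;> simp) hm (hf c)
    rw [sub_div, sub_right_comm, add_comm (1 / m)]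
    exact (abs_sub _ _).trans (add_le_add_right hi _)
  have hXY : ∀ c ∈ A, |(∑ u ∈ univ.erase w, X c u) - ∑ u ∈ univ.erase w, Y c u| ≤ k / m * P := by
    intro c hc
    rw [← sum_sub_distrib]
    refine (abs_sum_le_sum_abs _ _).trans ((sum_le_card_nsmul _ _ (1 / m * P) fun u hu =>
      abs_expect_planted_sub_le hm hf j w A h0 h1 hc (ne_of_mem_erase hu)).trans ?_)
    rw [nsmul_eq_mul]
    have : (#(univ.erase w) : ℝ) ≤ k := by
      exact_mod_cast (card_le_univ _).trans (by simp)
    calc (#(univ.erase w) : ℝ) * (1 / m * P) ≤ k * (1 / m * P) := by gcongr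
      _ = k / m * P := by ring
  rw [hX, mul_assoc, ← nsmul_eq_mul, ← sum_const, ← sum_sub_distrib]
  refine (abs_sum_le_sum_abs _ _).trans ?_
  unfold recursionError
  refine (sum_le_sum fun c hc => ?_).trans (sum_le_sum_of_subset_of_nonneg (subset_univ A)
    fun i _ _ => add_nonneg (by positivity) (expect_nonneg fun _ _ => abs_nonneg _))
  have := abs_sub_le (∑ u ∈ univ.erase w, X c u) (∑ u ∈ univ.erase w, Y c u)
    (b * 𝔼 G : BinsGraph k f, θ ^ rivalCount j w A G)
  linarith [hXY c hc, hY c]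

include hm hf in
/-- The number of surviving competitors is approximately Poisson: probability of the value `0`. -/
lemma abs_expect_zero_pow_rivalCount_sub_le (hb : 0 ≤ b) :
    |(𝔼 G : BinsGraph k f, (0 : ℝ) ^ rivalCount j w A G) - Real.exp (-(#A * b))| ≤
      recursionError k f m b j := by
  have hne : Nonempty (BinsGraph k f) :=
    ⟨fun _ i => ⟨0, by exact_mod_cast hm.trans_le (hf i)⟩⟩
  -- The generating function is run from argument 1, where it equals 1, down to argument 0, where `0
  -- ^ 0 = 1` makes it the probability of no rival.
  have hder : ∀ θ : ℝ, HasDerivAt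
      (fun θ : ℝ => 𝔼 G : BinsGraph k f, (1 - θ) ^ rivalCount j w A G)
      (-(𝔼 G : BinsGraph k f, (rivalCount j w A G : ℝ) * (1 - θ) ^ (rivalCount j w A G - 1))) θ := by
    intro θ
    simp only [Fintype.expect_eq_sum_div_card]
    rw [← neg_div, ← sum_neg_distrib]
    refine HasDerivAt.div_const (HasDerivAt.fun_sum fun G _ => ?_) _
    exact (((hasDerivAt_id' θ).const_sub 1).fun_pow (rivalCount j w A G)).congr_deriv (by simp)
  have := abs_sub_exp_le (a := #A * b) (δ := recursionError k f m b j) (by positivity) hder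
    (fun θ hθ => ?_) (by simp)
  · simpa using this
  · rw [← abs_neg, neg_add, neg_neg, ← sub_eq_add_neg]
    exact abs_expect_rivalCount_sub_le hm hf j w A (by linarith [hθ.2]) (by linarith [hθ.1])

lemma prod_one_sub_eq_sum (s : Finset (Fin d)) (x : Fin d → ℝ) :
    ∏ i ∈ s, (1 - x i) = ∑ A ∈ s.powerset, (-1) ^ #A * ∏ i ∈ A, x i := by
  simp [prod_sub]

include hm hf in
/-- One step of density evolution. -/
lemma abs_prob_survives_sub_le (hb : 0 ≤ b) (c : Fin d) :
    |prob (fun G : BinsGraph k f => survives some G (j + 1) (some c) w) -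
      (1 - Real.exp (-b)) ^ (d - 1)| ≤ 2 ^ (d - 1) * recursionError k f m b j := by
  have hcard : #((univ : Finset (Fin d)).erase c) = d - 1 := by simp
  -- Inclusion–exclusion over the classes without a surviving rival; `0 ^ N` is the indicator that
  -- all classes in `A` are such.
  have e1 : prob (fun G : BinsGraph k f => survives some G (j + 1) (some c) w) =
      ∑ A ∈ (univ.erase c).powerset, (-1) ^ #A *
        𝔼 G : BinsGraph k f, (0 : ℝ) ^ rivalCount j w A G := by
    simp_rw [mul_expect]
    rw [← expect_sum_comm]
    refine expect_congr rfl fun G _ => ?_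
    have : ∀ A, (0 : ℝ) ^ rivalCount j w A G = ∏ i ∈ A, (0 : ℝ) ^ #(rivals j G w i) := fun A =>
      (prod_pow_eq_pow_sum _ _ _).symm
    simp_rw [this]
    rw [← prod_one_sub_eq_sum]
    have hiff : survives some G (j + 1) (some c) w ↔
        ∀ i ∈ univ.erase c, (rivals j G w i).Nonempty := by
      simp only [survives, ne_eq, Option.some.injEq, mem_erase, mem_univ, and_true]
      refine forall_congr' fun i => imp_congr_right fun _ => ?_
      simp [rivals, Finset.Nonempty]
    split_ifs with h
    · rw [hiff] at h
      exact (prod_eq_one fun i hi => by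
        rw [zero_pow (card_ne_zero.2 (h i hi)), sub_zero]).symm
    · rw [hiff] at h
      push Not at h
      obtain ⟨i, hi, h⟩ := h
      exact (prod_eq_zero hi (by simp [h])).symm
  have e2 : (1 - Real.exp (-b)) ^ (d - 1) =
      ∑ A ∈ (univ.erase c).powerset, (-1) ^ #A * Real.exp (-(#A * b)) := by
    have := prod_one_sub_eq_sum (univ.erase c) fun _ => Real.exp (-b)
    rw [prod_const, hcard] at this
    rw [this]
    refine sum_congr rfl fun A _ => ?_
    rw [prod_const, ← Real.exp_nat_mul, mul_neg]
  rw [e1, e2, ← sum_sub_distrib]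
  refine (abs_sum_le_sum_abs _ _).trans ((sum_le_card_nsmul _ _
    (recursionError k f m b j) fun A _ => ?_).trans (le_of_eq ?_))
  · rw [← mul_sub, abs_mul, abs_pow, abs_neg, abs_one, one_pow, one_mul]
    exact abs_expect_zero_pow_rivalCount_sub_le hm hf j w A hb
  · rw [card_powerset, hcard, nsmul_eq_mul]
    push_cast
    rfl

end Recursion

lemma densityEvolution_pos {η : ℝ} (hη : 0 < η) (d j : ℕ) : 0 < densityEvolution d η j := by
  induction j with
  | zero => simp [densityEvolution]
  | succ j ih =>
    have : Real.exp (-(densityEvolution d η j / η)) < 1 :=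
      Real.exp_lt_one_iff.2 (neg_lt_zero.2 (div_pos ih hη))
    exact pow_pos (sub_pos.2 this) _

/-- With `m = ηk/2` the branching factor `k / m` stays constant, while the chance `n / m` of hitting
a visited node vanishes. -/
lemma tendsto_revisitBound {η : ℝ} (hη : 0 < η) (C : ℝ) (r n : ℕ) :
    Tendsto (fun p : ℕ × (Fin d → ℕ) => revisitBound d p.1 (η / 2 * p.1) r n)
      (regime d η C) (𝓝 0) := by
  have hk := tendsto_regime_fst d η C
  have h1 : Tendsto (fun p : ℕ × (Fin d → ℕ) => 1 / (η / 2 * (p.1 : ℝ))) (regime d η C) (𝓝 0) :=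
    (hk.const_mul_atTop (half_pos hη)).const_div_atTop 1
  induction r generalizing n with
  | zero => exact tendsto_const_nhds
  | succ r ih =>
    have := ((h1.const_mul (n : ℝ)).add ((ih (n + 1)).const_mul (2 / η))).const_mul (d : ℝ)
    simp only [mul_zero, add_zero] at this
    refine this.congr' ?_
    filter_upwards [hk.eventually_gt_atTop 0] with p hp
    rw [revisitBound, ← mul_assoc (p.1 : ℝ)]
    congr 3
    field_simp

/-- The density evolution: the limit of the proportion of survivors for the non-backtracking
decoder. -/
theorem tendsto_expect_survivors (hd : 1 ≤ d) {η : ℝ} (hη : 0 < η) (C : ℝ) (j : ℕ) :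
    ∀ c : Fin d, Tendsto (fun p : ℕ × (Fin d → ℕ) =>
      𝔼 G : BinsGraph p.1 p.2, (survivors some j (some c) G : ℝ) / p.1) (regime d η C)
      (𝓝 (densityEvolution d η j)) := by
  have hk := tendsto_regime_fst d η C
  induction j with
  | zero =>
    intro c
    refine tendsto_const_nhds.congr' ?_
    filter_upwards [hk.eventually_gt_atTop 0, eventually_regime_bounds hη C] with p hp hf
    have hfpos : ∀ i, (0 : ℝ) < p.2 i := fun i => lt_of_lt_of_le (by positivity) (hf i).1
    have hne : ∀ i, Nonempty (Fin (p.2 i)) := fun i => ⟨⟨0, by exact_mod_cast hfpos i⟩⟩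
    have : ∀ G : BinsGraph p.1 p.2, survivors some 0 (some c) G = p.1 := fun G => by
      rw [survivors, filter_true_of_mem (fun _ _ => by simp [survives]), card_univ, Fintype.card_fin]
    simp [this, densityEvolution, hp.ne']
  | succ j ih =>
    intro c
    set q := densityEvolution d η j with hq
    have hq0 : 0 < q := densityEvolution_pos hη d j
    have herr : Tendsto (fun p : ℕ × (Fin d → ℕ) =>
        recursionError p.1 p.2 (η / 2 * p.1) (q / η) j) (regime d η C) (𝓝 0) := by
      rw [show (0 : ℝ) = ∑ _i : Fin d, 0 by simp]
      refine tendsto_finsetSum _ fun i _ => ?_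
      have hr := tendsto_regime_ratio hη C i
      have h1 : Tendsto (fun p : ℕ × (Fin d → ℕ) => 1 / (η / 2 * (p.1 : ℝ)))
          (regime d η C) (𝓝 0) := (hk.const_mul_atTop (half_pos hη)).const_div_atTop 1
      have h2 := ((tendsto_revisitBound (d := d) hη C (j + 1) 2).add
        (tendsto_revisitBound hη C j 2)).const_mul (2 / η)
      have h3 : Tendsto (fun p : ℕ × (Fin d → ℕ) => 𝔼 G : BinsGraph p.1 p.2,
          |(survivors some j (some i) G : ℝ) / p.2 i - q / η|) (regime d η C) (𝓝 0) := by
        -- The fluctuation around the mean vanishes in `L¹` by concentration, and the mean converges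
        -- by the induction hypothesis.
        have hL1 := hr.mul (tendsto_expect_abs_survivors_sub hd hη C j some (some i))
        have hmean := ((hr.mul (ih i)).sub_const (q / η)).abs
        rw [show 1 / η * q - q / η = 0 by ring, abs_zero] at hmean
        have hsum := hL1.add hmean
        simp only [mul_zero, add_zero] at hsum
        refine squeeze_zero' (.of_forall fun _ => expect_nonneg fun _ _ => abs_nonneg _) ?_ hsum
        filter_upwards [hk.eventually_gt_atTop 0, eventually_regime_bounds hη C] with p hp hf
        have hfpos : ∀ i, (0 : ℝ) < p.2 i := fun i => lt_of_lt_of_le (by positivity) (hf i).1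
        have hne : ∀ i, Nonempty (Fin (p.2 i)) := fun i => ⟨⟨0, by exact_mod_cast hfpos i⟩⟩
        set μ := 𝔼 G : BinsGraph p.1 p.2, (survivors some j (some i) G : ℝ) / p.1
        rw [mul_expect, ← Fintype.expect_const (ι := BinsGraph p.1 p.2)
          |(p.1 : ℝ) / p.2 i * μ - q / η|, ← expect_add_distrib]
        refine expect_le_expect fun G _ => ?_
        have := hfpos i
        have e : (survivors some j (some i) G : ℝ) / p.2 i - q / η =
            (p.1 : ℝ) / p.2 i * ((survivors some j (some i) G : ℝ) / p.1 - μ) +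
              ((p.1 : ℝ) / p.2 i * μ - q / η) := by
          field_simp
          ring
        rw [e]
        refine (abs_add_le _ _).trans (le_of_eq ?_)
        rw [abs_mul, abs_of_pos (div_pos hp this)]
      have hsum := (h2.add h1).add h3
      simp only [mul_zero, add_zero] at hsum
      refine hsum.congr' ?_
      filter_upwards [hk.eventually_gt_atTop 0] with p hp
      congr 3
      field_simp
    rw [tendsto_iff_norm_sub_tendsto_zero]
    have hbound := herr.const_mul ((2 : ℝ) ^ (d - 1))
    rw [mul_zero] at hbound
    refine squeeze_zero' (.of_forall fun _ => norm_nonneg _) ?_ hbound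
    filter_upwards [hk.eventually_gt_atTop 0, eventually_regime_bounds hη C] with p hp hf
    have hp' : 0 < p.1 := by exact_mod_cast hp
    have hnek : Nonempty (Fin p.1) := ⟨⟨0, hp'⟩⟩
    have e : 𝔼 G : BinsGraph p.1 p.2, (survivors some (j + 1) (some c) G : ℝ) / p.1 =
        𝔼 w : Fin p.1, prob fun G : BinsGraph p.1 p.2 => survives some G (j + 1) (some c) w := by
      unfold prob
      rw [expect_comm]
      refine expect_congr rfl fun G _ => ?_
      rw [Fintype.expect_eq_sum_div_card, Fintype.card_fin, survivors, card_filter]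
      push_cast
      rfl
    have e' : densityEvolution d η (j + 1) =
        𝔼 _w : Fin p.1, (1 - Real.exp (-(q / η))) ^ (d - 1) := by
      rw [Fintype.expect_const]
      rfl
    rw [e, e', Real.norm_eq_abs, ← expect_sub_distrib]
    exact (abs_expect_le _ _).trans (expect_le univ_nonempty fun w _ =>
      abs_prob_survives_sub_le (by positivity) (fun i => (hf i).1) j w (div_pos hq0 hη).le c)

/-! ### The peeling decoder -/

lemma survives_of_succ {nxt : Fin d → Option (Fin d)} {G : BinsGraph k f} (j : ℕ) :
    ∀ {o : Option (Fin d)} {v : Fin k}, survives nxt G (j + 1) o v → survives nxt G j o v := by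
  induction j with
  | zero => intros; trivial
  | succ j ih =>
    intro o v h i hi
    obtain ⟨u, hu, hG, hs⟩ := h i hi
    exact ⟨u, hu, hG, ih hs⟩

/-- Ignoring a class only removes conditions for survival, at every level of the recursion. -/
lemma survives_some_of_none {G : BinsGraph k f} (j : ℕ) :
    ∀ (o : Option (Fin d)) (v : Fin k), survives (fun _ => none) G j none v →
      survives some G j o v := by
  induction j with
  | zero => intros; trivial
  | succ j ih =>
    intro o v h i _
    obtain ⟨u, hu, hG, hs⟩ := h i (by simp)
    exact ⟨u, hu, hG, ih _ u hs⟩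

lemma survivors_none_le (G : BinsGraph k f) (j : ℕ) (o : Option (Fin d)) :
    survivors (fun _ => none) j none G ≤ survivors some j o G :=
  card_le_card fun v hv => by
    simp only [mem_filter, mem_univ, true_and] at hv ⊢
    exact survives_some_of_none j o v hv

/-- All edges at a node are removed together, so the remaining graph is determined by the surviving
nodes, and a check node of degree one is one where a survivor has no surviving rival. Monotonicity
in the number of rounds is needed because level `j + 1` does not mention the survival of `v` at
level `j`. -/
lemma iterate_peelStep (G : BinsGraph k f) (j : ℕ) :
    peelStep^[j] (edges G) = (edges G).filter fun e => survives (fun _ => none) G j none e.1 := by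
  induction j with
  | zero => exact (filter_true_of_mem fun _ _ => by simp [survives]).symm
  | succ j ih =>
    rw [Function.iterate_succ_apply', ih]
    ext ⟨v, i₀, x₀⟩
    set E := (edges G).filter fun e => survives (fun _ => none) G j none e.1 with hE
    have hmem : ∀ u i x, (u, (⟨i, x⟩ : CheckNode f)) ∈ E ↔
        G u i = x ∧ survives (fun _ => none) G j none u := by
      intro u i x; simp [hE, edges]
    have key : survives (fun _ => none) G j none v →
        ((∃ e' ∈ E, checkDegree E e'.2 = 1 ∧ e'.1 = v) ↔
          ¬ survives (fun _ => none) G (j + 1) none v) := by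
      intro hv
      simp only [survives, not_forall]
      constructor
      · rintro ⟨⟨v', i, x⟩, he, hdeg, rfl⟩
        refine ⟨i, by simp, ?_⟩
        rintro ⟨u, hu, hG, hs⟩
        obtain ⟨a, ha⟩ := card_eq_one.1 hdeg
        have h1 : ∀ e ∈ E, e.2 = ⟨i, x⟩ → e = a := fun e he h => by
          rw [← mem_singleton, ← ha]
          exact mem_filter.2 ⟨he, h⟩
        have h2 := h1 _ he rfl
        have h3 := h1 (u, ⟨i, x⟩) ((hmem u i x).2 ⟨hG.trans ((hmem _ i x).1 he).1, hs⟩) rfl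
        exact hu (congrArg Prod.fst (h3.trans h2.symm))
      · rintro ⟨i, _, h⟩
        refine ⟨(v, ⟨i, G v i⟩), (hmem _ _ _).2 ⟨rfl, hv⟩, ?_, rfl⟩
        refine card_eq_one.2 ⟨(v, ⟨i, G v i⟩), ?_⟩
        ext ⟨u, i', x⟩
        simp only [mem_filter, mem_singleton, Prod.mk.injEq]
        constructor
        · rintro ⟨he, hc⟩
          refine ⟨?_, hc⟩
          by_contra hu
          cases hc
          obtain ⟨hG, hs⟩ := (hmem _ _ _).1 he
          exact h ⟨u, hu, hG, hs⟩
        · rintro ⟨rfl, hc⟩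
          cases hc
          exact ⟨(hmem _ _ _).2 ⟨rfl, hv⟩, rfl⟩
    rw [peelStep, mem_filter, hmem, mem_filter]
    have hedge : (v, (⟨i₀, x₀⟩ : CheckNode f)) ∈ edges G ↔ G v i₀ = x₀ := by simp [edges]
    rw [hedge]
    constructor
    · rintro ⟨⟨h1, h2⟩, h3⟩
      exact ⟨h1, by_contra fun h => h3 ((key h2).2 h)⟩
    · rintro ⟨h1, h2⟩
      have h3 := survives_of_succ j h2
      exact ⟨⟨h1, h3⟩, fun h => (key h3).1 h h2⟩

lemma undecodedEdges_eq (ℓ : ℕ) (G : BinsGraph k f) :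
    undecodedEdges ℓ G = d * survivors (fun _ => none) ℓ none G := by
  rw [undecodedEdges, iterate_peelStep, survivors]
  have : (edges G).filter (fun e => survives (fun _ => none) G ℓ none e.1) =
      ((univ : Finset (Fin d)) ×ˢ
        (univ.filter fun v => survives (fun _ => none) G ℓ none v)).image
        fun p => (p.2, (⟨p.1, G p.2 p.1⟩ : CheckNode f)) := by
    ext ⟨v, i, x⟩
    simp only [edges, mem_filter, mem_univ, true_and, mem_image, mem_product, Prod.exists,
      Prod.mk.injEq]
    constructor
    · rintro ⟨rfl, h⟩
      exact ⟨i, v, h, rfl, rfl⟩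
    · rintro ⟨i', v', h, rfl, hc⟩
      cases hc
      exact ⟨rfl, h⟩
  rw [this, card_image_of_injOn, card_product, card_univ, Fintype.card_fin]
  rintro ⟨i, v⟩ _ ⟨i', v'⟩ _ h
  simp only [Prod.mk.injEq, Sigma.mk.injEq] at h
  simp [h.1, h.2.1]

/-! ### The ensemble measure in terms of averages -/

lemma ensembleLaw_real (s : Set (BinsGraph k f)) :
    (ensembleLaw k f).real s = prob (fun G => G ∈ s) := by
  rw [ensembleLaw, measureReal_def, uniformOn_univ, prob, Fintype.expect_eq_sum_div_card,
    ← Set.coe_toFinset s, Measure.count_apply_finset, ENNReal.toReal_div]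
  simp

lemma integral_ensembleLaw (F : BinsGraph k f → ℝ) :
    ∫ G, F G ∂(ensembleLaw k f) = 𝔼 G, F G := by
  cases isEmpty_or_nonempty (BinsGraph k f)
  · rw [show F = 0 from Subsingleton.elim _ _]
    simp
  have : IsProbabilityMeasure (ensembleLaw k f) :=
    isProbabilityMeasure_uniformOn Set.finite_univ Set.univ_nonempty
  rw [integral_fintype (.of_finite), Fintype.expect_eq_sum_div_card, sum_div]
  refine sum_congr rfl fun G _ => ?_
  rw [ensembleLaw_real, prob, Fintype.expect_eq_sum_div_card]
  simp [div_eq_inv_mul]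

end PeelingDecoder

theorem mainTheorem4 (d : ℕ) (hd : 1 ≤ d) (η : ℝ) (hη : 0 < η) (ℓ : ℕ) :
    ∃ β : ℝ, 0 < β ∧ ∀ C ε₁ : ℝ, 0 < ε₁ → ∃ K : ℕ, ∀ k : ℕ, K ≤ k →
      ∀ f : Fin d → ℕ, (∀ i, |(f i : ℝ) - η * (k : ℝ)| ≤ C) →
        (∫ G, (undecodedEdges ℓ G : ℝ) ∂(ensembleLaw k f)
            < 2 * (k : ℝ) * (d : ℝ) * densityEvolution d η ℓ) ∧
        (ensembleLaw k f).real
            {G | (k : ℝ) * (d : ℝ) * ε₁ <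
              |(undecodedEdges ℓ G : ℝ) -
                ∫ G', (undecodedEdges ℓ G' : ℝ) ∂(ensembleLaw k f)|}
          < Real.exp (-(β * ε₁ ^ 2 * (k : ℝ) ^ ((1 : ℝ) / (4 * (ℓ : ℝ) + 1)))) := by
  open PeelingDecoder in
  obtain ⟨β, hβ, H⟩ := exists_prob_survivors_deviation_lt hd hη ℓ
  refine ⟨β, hβ, fun C ε₁ hε => ?_⟩
  have hd0 : (0 : ℝ) < d := by exact_mod_cast hd
  have hp := densityEvolution_pos hη d ℓ
  -- Positivity of the limit turns convergence into a strict bound by its double. The ignored class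
  -- 0 exists because `d ≥ 1`; any class would serve.
  have hev : ∀ᶠ p in regime d η C, _ :=
    ((tendsto_expect_survivors hd hη C ℓ ⟨0, hd⟩).eventually_lt_const
      (show densityEvolution d η ℓ < 2 * densityEvolution d η ℓ by linarith)).and
    (((tendsto_regime_fst d η C).eventually_gt_atTop 0).and (H (fun _ => none) C ε₁ hε))
  obtain ⟨K, hK⟩ := eventually_regime_iff.1 hev
  refine ⟨K, fun k hk f hf => ?_⟩
  obtain ⟨h1, h2, h3⟩ := hK k hk f hf
  simp only at h1 h2 h3
  have hZ : ∀ G : BinsGraph k f,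
      (undecodedEdges ℓ G : ℝ) = d * survivors (fun _ => none) ℓ none G := fun G => by
    rw [undecodedEdges_eq, Nat.cast_mul]
  simp only [integral_ensembleLaw, hZ, ← Finset.mul_expect]
  constructor
  · rw [← Finset.expect_div, div_lt_iff₀ h2] at h1
    have hle : Finset.univ.expect (fun G : BinsGraph k f =>
        (survivors (fun _ => none) ℓ none G : ℝ)) ≤ Finset.univ.expect
        (fun G : BinsGraph k f => (survivors some ℓ (some ⟨0, hd⟩) G : ℝ)) := by
      exact Finset.expect_le_expect fun G _ => Nat.cast_le.2 (survivors_none_le G ℓ _)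
    nlinarith
  · rw [ensembleLaw_real]
    refine lt_of_le_of_lt (prob_mono fun G hG => ?_) (h3 none)
    rw [Set.mem_ofPred_eq, ← mul_sub, abs_mul, abs_of_pos hd0, mul_right_comm, mul_comm (d : ℝ)]
      at hG
    exact lt_of_mul_lt_mul_right hG hd0.le
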